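/- Let $R$ be a division ring of characteristic different from $2$ and let $V$ be a left vector space over $R$ of finite dimension $n = 2k \ge 8$. For $u \in \mathrm{GL}(V)$ put $S_+(u) = \{x \in V : u(x) = x\}$ and $S_-(u) = \{x \in V : u(x) = -x\}$. An element $u \in \mathrm{GL}(V)$ with $u^2 = 1$ is called a $(k,n-k)$-involution if $\dim S_+(u) = k$ and $\dim S_-(u) = n-k$; let $\mathfrak{I}_k$ be the set of all $(k,n-k)$-involutions. Let $f : \mathfrak{I}_k \to \mathfrak{I}_k$ be a commutativity preserving bijection, that is, a bijection such that both $f$ and $f^{-1}$ map commuting involutions to commuting involutions. Then there exists an automorphism $f'$ of the group $\mathrm{GL}(V)$ such that for every $u \in \mathfrak{I}_k$ one has $f(u) = f'(u)$ or $f(u) = -f'(u)$ (the sign may depend on $u$). -/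

import Mathlib

namespace LinInv

variable {R : Type*} [DivisionRing R] {V : Type*} [AddCommGroup V] [Module R V]

/-- The subspace `S₊(u)` of all vectors `x` with `u x = x`. -/
def fixedSpace (u : LinearMap.GeneralLinearGroup R V) : Submodule R V :=
  LinearMap.ker ((u : V →ₗ[R] V) - LinearMap.id)

/-- The subspace `S₋(u)` of all vectors `x` with `u x = -x`. -/
def negSpace (u : LinearMap.GeneralLinearGroup R V) : Submodule R V :=
  LinearMap.ker ((u : V →ₗ[R] V) + LinearMap.id)

theorem mem_fixedSpace (u : LinearMap.GeneralLinearGroup R V) (x : V) :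
    x ∈ fixedSpace u ↔ (u : V →ₗ[R] V) x = x := by
  simp [fixedSpace, sub_eq_zero]

theorem mem_negSpace (u : LinearMap.GeneralLinearGroup R V) (x : V) :
    x ∈ negSpace u ↔ (u : V →ₗ[R] V) x = -x := by
  simp [negSpace, add_eq_zero_iff_eq_neg]

variable (R V) in
/-- The set of `(p, q)`-involutions of `V`: elements `u` of `GL(V)` with `u² = 1`, `dim S₊(u) = p`
and `dim S₋(u) = q`. -/
def involutions (p q : ℕ) : Set (LinearMap.GeneralLinearGroup R V) :=
  {u | u * u = 1 ∧ Module.finrank R (fixedSpace u) = p ∧ Module.finrank R (negSpace u) = q}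

/-- A bijective transformation `f` of a set `I` of elements of a group is commutativity preserving
if `f` and its inverse send commuting elements to commuting elements. -/
def CommutativityPreserving {G : Type*} [Group G] {I : Set G} (f : I ≃ I) : Prop :=
  (∀ u v : I, Commute (u : G) (v : G) → Commute (f u : G) (f v : G)) ∧
  (∀ u v : I, Commute (u : G) (v : G) → Commute (f.symm u : G) (f.symm v : G))

end LinInv

/-!
Up to sign, a `(k, k)`-involution is an unordered decomposition of `V` into two subspaces of
dimension `k`, and two involutions commute precisely if they are diagonal in a common basis. The
proof recovers from commutativity the projections of `V` onto lines, and from these projective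
geometry.

*Frames.* The `(k, k)`-involutions that are diagonal in a basis `b` correspond to the `k`-subsets of
the index set. By counting and simultaneous diagonalization, `f` maps them onto those diagonal in
another basis. The families of such involutions that fail to separate two basis vectors are
recognized by commutativity (`nonseparating_of_commutativityPreserving`). Hence `f` induces a
bijection of the pairs of indices; a parity argument shows that it preserves triangles, so it comes
from a bijection of the indices. This gives a basis `b'` such that `f (diag b S) = ± diag b' S` for
all `k`-subsets `S` (`exists_isImage`).

*Line projections.* If two bases differ by an elementary move in the plane of two of their vectors,
then `f` maps all other projections of the two frames in the same way
(`IsImage.proj_eq_of_diag_eq`). Any two bases that share a line and a complementary hyperplane are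
connected by such moves fixing these (`of_forall_addMul`). Hence `f` induces a bijection `F` of the
set of projections onto lines (`exists_equiv_lineProjections`). It preserves orthogonality.

*Projective geometry.* Orthogonality determines whether two line projections have the same range or
the same kernel (`sameRange_or_sameKer_iff`). It follows that `F` preserves these two relations or
interchanges them (`preserves_or_swaps_of_orth`). In the first case `F` induces a collineation, and
the fundamental theorem of projective geometry (`IsCollineation.exists_semilinear`) shows that `F`
is the conjugation by a semilinear bijection of `V`. In the second case the same applies to `F`
followed by transposition, a bijection onto the line projections of the dual space over the opposite
ring. Accordingly, `f'` is conjugation by a semilinear bijection of `V` or a contragredient map.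
-/

namespace LinInv

/-! ### Permutations of the middle layer of a Boolean cube -/

section Combinatorics

theorem iff_parity (p q r : Prop) : (((p ↔ q) ↔ (p ↔ r)) ↔ (q ↔ r)) := by tauto

variable {ι : Type*} [DecidableEq ι]

theorem finset_pair_eq_pair_iff {a b c d : ι} :
    ({a, b} : Finset ι) = {c, d} ↔ a = c ∧ b = d ∨ a = d ∧ b = c := by
  rw [← Finset.coe_inj]
  push_cast
  exact Set.pair_eq_pair_iff

theorem separates_congr {a b c d : ι} (h : ({a, b} : Finset ι) = {c, d}) (S : Finset ι) :
    (a ∈ S ↔ b ∈ S) ↔ (c ∈ S ↔ d ∈ S) := by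
  rcases finset_pair_eq_pair_iff.1 h with ⟨rfl, rfl⟩ | ⟨rfl, rfl⟩ <;> tauto

theorem pair_eq_of_mem {a b x y : ι} (hxy : x ≠ y) (hx : x ∈ ({a, b} : Finset ι))
    (hy : y ∈ ({a, b} : Finset ι)) : ({a, b} : Finset ι) = {x, y} := by
  grind

theorem pair_ne_pair {a b c d : ι} (x : ι) (hx : x = c ∨ x = d) (ha : x ≠ a) (hb : x ≠ b) :
    ({a, b} : Finset ι) ≠ {c, d} := by
  intro h
  have : x ∈ ({a, b} : Finset ι) := by rw [h]; simpa using hx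
  simp [ha, hb] at this

variable [Fintype ι]

theorem exists_card_eq_subset_disjoint {k : ℕ} (hι : Fintype.card ι = 2 * k) (A B : Finset ι)
    (hAB : Disjoint A B) (hA : A.card ≤ k) (hB : B.card ≤ k) :
    ∃ S : Finset ι, S.card = k ∧ A ⊆ S ∧ Disjoint B S := by
  obtain ⟨S, h1, h2, h3⟩ := Finset.exists_subsuperset_card_eq (s := A) (t := Bᶜ) (n := k)
    (by rwa [Finset.subset_compl_iff_disjoint_right]) hA
    (by rw [Finset.card_compl]; omega)
  exact ⟨S, h3, h1, (Finset.subset_compl_iff_disjoint_right.1 h2).symm⟩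

theorem exists_ne_of_card {m : ℕ} (hm : m < Fintype.card ι) (A : Finset ι) (hA : A.card ≤ m) :
    ∃ x, x ∉ A := by
  by_contra hcon
  push Not at hcon
  have := Finset.card_le_card (fun y (_ : y ∈ Finset.univ) => hcon y)
  rw [Finset.card_univ] at this
  omega

/-- Two pairs of points that are separated by the same `k`-subsets coincide. -/
theorem pair_eq_of_forall_separates {k : ℕ} (hk : 4 ≤ k) (hι : Fintype.card ι = 2 * k)
    {i j a b : ι} (hab : a ≠ b)
    (h : ∀ S : Finset ι, S.card = k → (i ∈ S ↔ j ∈ S) → (a ∈ S ↔ b ∈ S)) :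
    ({i, j} : Finset ι) = {a, b} := by
  by_contra hne
  by_cases ha : a = i ∨ a = j
  · have hb : b ≠ i ∧ b ≠ j := by
      constructor <;> rintro rfl <;> rcases ha with rfl | rfl <;>
        simp_all [Finset.pair_comm]
    obtain ⟨S, hS, h1, h2⟩ := exists_card_eq_subset_disjoint hι {i, j} {b}
      (by simp [hb]) (Finset.card_le_two.trans (by omega)) (by simp; omega)
    have hi : i ∈ S := h1 (by simp)
    have hj : j ∈ S := h1 (by simp)
    have hb' : b ∉ S := by simpa using h2
    have := h S hS (by simp [hi, hj])
    rcases ha with rfl | rfl <;> simp_all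
  · push Not at ha
    obtain ⟨S, hS, h1, h2⟩ := exists_card_eq_subset_disjoint hι {a} {b, i, j}
      (by simp [hab, ha]) (by simp; omega) (Finset.card_le_three.trans (by omega))
    have ha' : a ∈ S := h1 (by simp)
    simp at h2
    have := h S hS (by simp [h2])
    simp_all

/-- If every `k`-subset separates an even number of three distinct pairs, then
these are the sides of a triangle. -/
theorem triangle_of_parity {k : ℕ} (hk : 4 ≤ k) (hι : Fintype.card ι = 2 * k)
    {a b c d e g : ι} (hab : a ≠ b) (hcd : c ≠ d) (heg : e ≠ g)
    (h : ∀ S : Finset ι, S.card = k →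
      (((a ∈ S ↔ b ∈ S) ↔ (c ∈ S ↔ d ∈ S)) ↔ (e ∈ S ↔ g ∈ S)))
    (h1 : ({a, b} : Finset ι) ≠ {c, d}) (h2 : ({a, b} : Finset ι) ≠ {e, g})
    (h3 : ({c, d} : Finset ι) ≠ {e, g}) :
    ∃ x y z : ι, x ≠ y ∧ y ≠ z ∧ x ≠ z ∧ ({a, b} : Finset ι) = {x, y} ∧
      ({c, d} : Finset ι) = {x, z} ∧ ({e, g} : Finset ι) = {y, z} := by
  -- Exchanging `x` for a point outside all three pairs changes the parity for the pairs at `x`.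
  have key : ∀ x : ι, ((x = a ∨ x = b) ↔ (x = c ∨ x = d)) ↔ ¬ (x = e ∨ x = g) := by
    intro x
    obtain ⟨w, hw⟩ := exists_ne_of_card (m := 7) (by omega) {a, b, c, d, e, g, x}
      ((Finset.card_insert_le _ _).trans (Nat.succ_le_succ Finset.card_le_six))
    simp only [Finset.mem_insert, Finset.mem_singleton, not_or] at hw
    obtain ⟨S, hS, hx, hwS⟩ := exists_card_eq_subset_disjoint hι {x} {w}
      (by simp; tauto) (by simp; omega) (by simp; omega)
    have hx : x ∈ S := hx (by simp)
    have hwS : w ∉ S := by simpa using hwS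
    have hT := h (insert w (S.erase x)) (by
      rw [Finset.card_insert_of_notMem (by simp [hwS]), Finset.card_erase_of_mem hx]
      omega)
    have hS' := h S hS
    simp only [Finset.mem_insert, Finset.mem_erase] at hT
    grind
  have ka := key a
  have kb := key b
  have kc := key c
  have kd := key d
  have ke := key e
  have kg := key g
  have pc := fun x y : ι => Finset.pair_comm x y
  by_cases hac : a = c
  · subst hac
    have hbd : b ≠ d := by rintro rfl; exact h1 rfl
    refine ⟨a, b, d, hab, hbd, hcd, rfl, rfl, ?_⟩
    grind
  by_cases had : a = d
  · subst had
    refine ⟨a, b, c, hab, by grind, hac, rfl, pc _ _, by grind⟩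
  by_cases hbc : b = c
  · subst hbc
    refine ⟨b, a, d, hab.symm, had, hcd, pc _ _, rfl, by grind⟩
  by_cases hbd : b = d
  · subst hbd
    refine ⟨b, a, c, hab.symm, hac, hcd.symm, pc _ _, pc _ _, by grind⟩
  exfalso
  apply h2
  grind

/-- A permutation `φ` of the `k`-subsets of a set with `2k ≥ 8` points, such that `φ` and its
inverse preserve the families that fail to separate some pair of points, is induced up to
complementation by a permutation of the points. -/
theorem exists_perm_of_preserves_nonseparating {k : ℕ} (hk : 4 ≤ k)
    (hι : Fintype.card ι = 2 * k) (φ : {S : Finset ι // S.card = k} ≃ {S : Finset ι // S.card = k})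
    (h : ∀ Y : Set {S : Finset ι // S.card = k},
      (∃ i j : ι, i ≠ j ∧ ∀ S ∈ Y, (i ∈ S.1 ↔ j ∈ S.1)) →
      ∃ i j : ι, i ≠ j ∧ ∀ S ∈ Y, (i ∈ (φ S).1 ↔ j ∈ (φ S).1))
    (h' : ∀ Y : Set {S : Finset ι // S.card = k},
      (∃ i j : ι, i ≠ j ∧ ∀ S ∈ Y, (i ∈ S.1 ↔ j ∈ S.1)) →
      ∃ i j : ι, i ≠ j ∧ ∀ S ∈ Y, (i ∈ (φ.symm S).1 ↔ j ∈ (φ.symm S).1)) :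
    ∃ σ : Equiv.Perm ι, ∀ S, (∀ i, σ i ∈ (φ S).1 ↔ i ∈ S.1) ∨ (∀ i, σ i ∈ (φ S).1 ↔ i ∉ S.1) := by
  have hpair : ∀ i j : ι, i ≠ j → ∃ a b : ι, a ≠ b ∧
      ∀ S, (i ∈ S.1 ↔ j ∈ S.1) ↔ (a ∈ (φ S).1 ↔ b ∈ (φ S).1) := by
    intro i j hij
    obtain ⟨a, b, hab, H⟩ := h {S | i ∈ S.1 ↔ j ∈ S.1} ⟨i, j, hij, fun S hS => hS⟩
    obtain ⟨c, d, hcd, H'⟩ := h' {S | a ∈ S.1 ↔ b ∈ S.1} ⟨a, b, hab, fun S hS => hS⟩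
    have e := pair_eq_of_forall_separates hk hι hcd (i := i) (j := j) fun S hS hS' => by
      have := H' (φ ⟨S, hS⟩) (H ⟨S, hS⟩ hS')
      simpa using this
    refine ⟨a, b, hab, fun S => ⟨fun hS => H S hS, fun hS => ?_⟩⟩
    have := H' (φ S) hS
    simp only [Equiv.symm_apply_apply] at this
    exact (separates_congr e S.1).2 this
  choose! α β hαβ hrel using hpair
  have hinj : ∀ i j l m, i ≠ j → l ≠ m → ({α i j, β i j} : Finset ι) = {α l m, β l m} →
      ({i, j} : Finset ι) = {l, m} := by
    intro i j l m hij hlm he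
    refine pair_eq_of_forall_separates hk hι hlm fun S hS hS' => ?_
    have h1 := (hrel i j hij ⟨S, hS⟩).1 hS'
    exact (hrel l m hlm ⟨S, hS⟩).2 ((separates_congr he _).1 h1)
  have htri : ∀ i j l, i ≠ j → i ≠ l → j ≠ l → ∃ x y z : ι, x ≠ y ∧ y ≠ z ∧ x ≠ z ∧
      ({α i j, β i j} : Finset ι) = {x, y} ∧ ({α i l, β i l} : Finset ι) = {x, z} ∧
      ({α j l, β j l} : Finset ι) = {y, z} := by
    intro i j l hij hil hjl
    refine triangle_of_parity hk hι (hαβ _ _ hij) (hαβ _ _ hil) (hαβ _ _ hjl) ?_ ?_ ?_ ?_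
    · intro T hT
      have e : φ (φ.symm ⟨T, hT⟩) = ⟨T, hT⟩ := φ.apply_symm_apply _
      have h1 := hrel i j hij (φ.symm ⟨T, hT⟩)
      have h2 := hrel i l hil (φ.symm ⟨T, hT⟩)
      have h3 := hrel j l hjl (φ.symm ⟨T, hT⟩)
      rw [e] at h1 h2 h3
      rw [← h1, ← h2, ← h3]
      exact iff_parity _ _ _
    · exact fun he => pair_ne_pair l (Or.inr rfl) hil.symm hjl.symm (hinj _ _ _ _ hij hil he)
    · exact fun he => pair_ne_pair l (Or.inr rfl) hil.symm hjl.symm (hinj _ _ _ _ hij hjl he)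
    · exact fun he => pair_ne_pair j (Or.inl rfl) hij.symm hjl (hinj _ _ _ _ hil hjl he)
  have hsymm : ∀ i j, i ≠ j → ({α i j, β i j} : Finset ι) = {α j i, β j i} := by
    intro i j hij
    refine pair_eq_of_forall_separates hk hι (hαβ _ _ hij.symm) fun T hT hT' => ?_
    have e : φ (φ.symm ⟨T, hT⟩) = ⟨T, hT⟩ := φ.apply_symm_apply _
    have h1 := hrel i j hij (φ.symm ⟨T, hT⟩)
    have h2 := hrel j i hij.symm (φ.symm ⟨T, hT⟩)
    rw [e] at h1 h2
    exact h2.1 (h1.2 hT').symm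
  -- The images of the pairs at `i` have a common point.
  have hstar : ∀ i, ∃ a, ∀ m, m ≠ i → a ∈ ({α i m, β i m} : Finset ι) := by
    intro i
    obtain ⟨j, hj⟩ := exists_ne_of_card (m := 1) (by omega) {i} (by simp)
    obtain ⟨l, hl⟩ := exists_ne_of_card (m := 2) (by omega) {i, j} Finset.card_le_two
    simp only [Finset.mem_insert, Finset.mem_singleton, not_or] at hj hl
    obtain ⟨x, y, z, hxy, hyz, hxz, e1, e2, e3⟩ := htri i j l (Ne.symm hj) (Ne.symm hl.1)
      (Ne.symm hl.2)
    refine ⟨x, fun m hm => ?_⟩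
    by_cases hmj : m = j
    · subst hmj; rw [e1]; simp
    by_cases hml : m = l
    · subst hml; rw [e2]; simp
    by_contra hx
    obtain ⟨x', y', z', -, -, -, f1, f2, -⟩ := htri i m j hm.symm (Ne.symm hj) hmj
    obtain ⟨x'', y'', z'', -, -, -, g1, g2, -⟩ := htri i m l hm.symm (Ne.symm hl.1) hml
    have k1 : y ∈ ({α i m, β i m} : Finset ι) := by
      have h1 : x' ∈ ({α i j, β i j} : Finset ι) := by rw [f2]; simp
      have h2 : x' ∈ ({α i m, β i m} : Finset ι) := by rw [f1]; simp
      rw [e1, Finset.mem_insert, Finset.mem_singleton] at h1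
      rcases h1 with rfl | rfl
      exacts [absurd h2 hx, h2]
    have k2 : z ∈ ({α i m, β i m} : Finset ι) := by
      have h1 : x'' ∈ ({α i l, β i l} : Finset ι) := by rw [g2]; simp
      have h2 : x'' ∈ ({α i m, β i m} : Finset ι) := by rw [g1]; simp
      rw [e2, Finset.mem_insert, Finset.mem_singleton] at h1
      rcases h1 with rfl | rfl
      exacts [absurd h2 hx, h2]
    have e4 := (pair_eq_of_mem hyz k1 k2).trans e3.symm
    exact pair_ne_pair j (Or.inl rfl) hj (Ne.symm hmj) (hinj _ _ _ _ hm.symm (Ne.symm hl.2) e4)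
  choose σ hσ using hstar
  have hσne : ∀ i j, i ≠ j → σ i ≠ σ j := by
    intro i j hij he
    obtain ⟨l, hl⟩ := exists_ne_of_card (m := 2) (by omega) {i, j} Finset.card_le_two
    simp only [Finset.mem_insert, Finset.mem_singleton, not_or] at hl
    obtain ⟨x, y, z, hxy, hyz, hxz, e1, e2, e3⟩ := htri i j l hij (Ne.symm hl.1) (Ne.symm hl.2)
    have h1 := hσ i j hij.symm
    have h2 := hσ i l hl.1
    have h3 := hσ j l hl.2
    rw [← he] at h3
    rw [e1] at h1; rw [e2] at h2; rw [e3] at h3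
    simp only [Finset.mem_insert, Finset.mem_singleton] at h1 h2 h3
    grind only
  have hσpair : ∀ i j, i ≠ j → ({α i j, β i j} : Finset ι) = {σ i, σ j} := by
    intro i j hij
    have h1 := hσ i j hij.symm
    have h2 := hσ j i hij
    rw [← hsymm i j hij] at h2
    exact pair_eq_of_mem (hσne i j hij) h1 h2
  have hσinj : Function.Injective σ := fun i j hij => by
    by_contra hne
    exact hσne i j hne hij
  refine ⟨Equiv.ofBijective σ hσinj.bijective_of_finite, fun S => ?_⟩
  have hsep : ∀ i j, (i ∈ S.1 ↔ j ∈ S.1) ↔ (σ i ∈ (φ S).1 ↔ σ j ∈ (φ S).1) := by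
    intro i j
    by_cases hij : i = j
    · subst hij; simp
    have h1 := hrel i j hij S
    exact h1.trans (separates_congr (hσpair i j hij) _)
  obtain ⟨i₀, hi₀⟩ : S.1.Nonempty := Finset.card_pos.1 (by rw [S.2]; omega)
  simp only [Equiv.ofBijective_apply]
  by_cases h0 : σ i₀ ∈ (φ S).1
  · left; intro i; have := hsep i i₀; tauto
  · right; intro i; have := hsep i i₀; tauto

end Combinatorics

/-! ### Diagonal involutions -/

section Diagonal

open Module

variable {R : Type*} [DivisionRing R] {V : Type*} [AddCommGroup V] [Module R V]
variable {ι : Type*} [DecidableEq ι]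

/-- The involution which is the identity on the vectors `b i` with `i ∈ S` and minus the identity
on the other vectors of the basis `b`. -/
noncomputable def diag (b : Basis ι R V) (S : Finset ι) : End R V :=
  b.constr ℕ fun i => if i ∈ S then b i else -b i

theorem diag_apply (b : Basis ι R V) (S : Finset ι) (i : ι) :
    diag b S (b i) = if i ∈ S then b i else -b i := by
  simp [diag]

theorem repr_diag (b : Basis ι R V) (S : Finset ι) (v : V) (i : ι) :
    b.repr (diag b S v) i = if i ∈ S then b.repr v i else -b.repr v i := by
  have : b.coord i ∘ₗ diag b S = if i ∈ S then b.coord i else -b.coord i := by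
    refine b.ext fun j => ?_
    rw [LinearMap.comp_apply, diag_apply]
    by_cases hij : j = i
    · subst hij; by_cases hj : j ∈ S <;> simp [hj]
    · by_cases hj : j ∈ S <;> by_cases hi : i ∈ S <;> simp [hj, hi, hij]
  have h := LinearMap.congr_fun this v
  by_cases hi : i ∈ S <;> simpa [hi] using h

theorem diag_mul_self (b : Basis ι R V) (S : Finset ι) : diag b S * diag b S = 1 := by
  refine b.ext fun i => ?_
  by_cases hi : i ∈ S <;> simp [diag_apply, hi]

theorem diag_comm (b : Basis ι R V) (S T : Finset ι) :
    diag b S * diag b T = diag b T * diag b S := by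
  refine b.ext fun i => ?_
  by_cases hi : i ∈ S <;> by_cases hj : i ∈ T <;> simp [diag_apply, hi, hj]

theorem neg_diag [Fintype ι] (b : Basis ι R V) (S : Finset ι) : -diag b S = diag b Sᶜ := by
  refine b.ext fun i => ?_
  by_cases hi : i ∈ S <;> simp [diag_apply, hi]

theorem eq_neg_iff_eq_zero (h2 : (2 : R) ≠ 0) {x : V} : x = -x ↔ x = 0 := by
  rw [eq_neg_iff_add_eq_zero, ← two_smul R, smul_eq_zero]
  simp [h2]

theorem mem_of_diag_apply_eq (h2 : (2 : R) ≠ 0) (b : Basis ι R V) {S : Finset ι} {i : ι} :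
    diag b S (b i) = b i ↔ i ∈ S := by
  rw [diag_apply]
  by_cases hi : i ∈ S
  · simp [hi]
  · simp only [hi, if_false, iff_false]
    intro h
    exact b.ne_zero i ((eq_neg_iff_eq_zero h2).1 h.symm)

theorem diag_injective (h2 : (2 : R) ≠ 0) (b : Basis ι R V) :
    Function.Injective (diag b) := by
  intro S T h
  ext i
  rw [← mem_of_diag_apply_eq h2 b, h, mem_of_diag_apply_eq h2 b]

/-- An endomorphism commuting with `diag b S` has no matrix entry at indices separated by `S`. -/
theorem repr_eq_zero_of_commute (h2 : (2 : R) ≠ 0) (b : Basis ι R V) {S : Finset ι} {i j : ι}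
    (hS : ¬ (i ∈ S ↔ j ∈ S)) {v : End R V} (hv : v * diag b S = diag b S * v) :
    b.repr (v (b i)) j = 0 := by
  have h := congrArg (fun x => b.repr x j) (LinearMap.congr_fun hv (b i))
  simp only [Module.End.mul_apply, repr_diag, diag_apply] at h
  by_cases hi : i ∈ S <;> by_cases hj : j ∈ S
  · simp [hi, hj] at hS
  · simp only [hi, hj, if_true, if_false] at h
    exact (eq_neg_iff_eq_zero h2).1 h
  · simp only [hi, hj, if_true, if_false, map_neg, Finsupp.neg_apply] at h
    exact (eq_neg_iff_eq_zero h2).1 h.symm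
  · simp [hi, hj] at hS

/-- An endomorphism commuting with enough involutions that are diagonal in a basis commutes with
all of them. -/
theorem commute_diag_of_separating (h2 : (2 : R) ≠ 0) (b : Basis ι R V) {Y : Set (Finset ι)}
    (hY : ∀ i j, i ≠ j → ∃ S ∈ Y, ¬ (i ∈ S ↔ j ∈ S)) {v : End R V}
    (hv : ∀ S ∈ Y, v * diag b S = diag b S * v) (T : Finset ι) :
    v * diag b T = diag b T * v := by
  refine b.ext fun i => ?_
  have hvi : v (b i) = b.repr (v (b i)) i • b i := by
    apply b.ext_elem
    intro j
    by_cases hij : i = j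
    · subst hij; simp
    · obtain ⟨S, hS, hsep⟩ := hY i j hij
      rw [repr_eq_zero_of_commute h2 b hsep (hv S hS)]
      simp [hij]
  simp only [Module.End.mul_apply, diag_apply]
  rw [hvi, map_smul, diag_apply]
  by_cases hi : i ∈ T
  · simp only [hi, if_true]; exact hvi
  · simp only [hi, if_false, map_neg, smul_neg, neg_inj]; exact hvi

theorem ker_diag_sub_id (h2 : (2 : R) ≠ 0) (b : Basis ι R V) (S : Finset ι) :
    LinearMap.ker (diag b S - LinearMap.id) = Submodule.span R (b '' S) := by
  ext v
  rw [LinearMap.mem_ker, b.mem_span_image, LinearMap.sub_apply, LinearMap.id_apply, sub_eq_zero,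
    b.ext_elem_iff]
  constructor
  · intro h i hi
    by_contra hiS
    have := h i
    rw [repr_diag, if_neg (by simpa using hiS)] at this
    exact (Finsupp.mem_support_iff.1 hi) ((eq_neg_iff_eq_zero h2).1 this.symm)
  · intro h i
    rw [repr_diag]
    split_ifs with hi
    · rfl
    · have : b.repr v i = 0 := by
        by_contra hne
        exact hi (by simpa using h (Finsupp.mem_support_iff.2 hne))
      simp [this]

theorem finrank_ker_diag_sub_id (h2 : (2 : R) ≠ 0) (b : Basis ι R V) (S : Finset ι) :
    finrank R (LinearMap.ker (diag b S - LinearMap.id)) = S.card := by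
  classical
  rw [ker_diag_sub_id h2, ← Finset.coe_image, finrank_span_finset_eq_card,
    Finset.card_image_of_injective _ b.injective]
  rw [Finset.coe_image]
  have := b.linearIndependent.linearIndepOn_id
  exact this.mono (by rintro _ ⟨i, -, rfl⟩; exact ⟨i, rfl⟩)

theorem ker_add_id (u : End R V) :
    LinearMap.ker (u + LinearMap.id) = LinearMap.ker (-u - LinearMap.id) := by
  rw [← LinearMap.ker_neg]
  congr 1
  abel

/-- `diag b S` as an element of the general linear group. -/
noncomputable def diagGL (b : Basis ι R V) (S : Finset ι) : LinearMap.GeneralLinearGroup R V :=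
  ⟨diag b S, diag b S, diag_mul_self b S, diag_mul_self b S⟩

variable [Fintype ι]

theorem finrank_ker_diag_add_id (h2 : (2 : R) ≠ 0) (b : Basis ι R V) (S : Finset ι) :
    finrank R (LinearMap.ker (diag b S + LinearMap.id)) = Sᶜ.card := by
  rw [ker_add_id, neg_diag, finrank_ker_diag_sub_id h2]

theorem diagGL_mem_involutions (h2 : (2 : R) ≠ 0) {k : ℕ} (hι : Fintype.card ι = 2 * k)
    (b : Basis ι R V) {S : Finset ι} (hS : S.card = k) : diagGL b S ∈ involutions R V k k := by
  refine ⟨Units.ext (diag_mul_self b S), ?_, ?_⟩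
  · exact (finrank_ker_diag_sub_id h2 b S).trans hS
  · exact (finrank_ker_diag_add_id h2 b S).trans (by rw [Finset.card_compl]; omega)

/-- The common eigenvectors of finitely many commuting involutions span the space. -/
theorem span_common_eigenvectors (h2 : (2 : R) ≠ 0) (A : Finset (End R V))
    (hinv : ∀ u ∈ A, u * u = 1) (hcomm : ∀ u ∈ A, ∀ w ∈ A, u * w = w * u) :
    Submodule.span R {x : V | ∀ u ∈ A, u x = x ∨ u x = -x} = ⊤ := by
  classical
  induction A using Finset.induction_on with
  | empty => simp
  | insert u A hu ih =>
    have ih := ih (fun w hw => hinv w (Finset.mem_insert_of_mem hw))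
      (fun w hw w' hw' => hcomm w (Finset.mem_insert_of_mem hw) w' (Finset.mem_insert_of_mem hw'))
    rw [← top_le_iff, ← ih, Submodule.span_le]
    intro x hx
    have huu : ∀ y, u (u y) = y := fun y =>
      LinearMap.congr_fun (hinv u (Finset.mem_insert_self _ _)) y
    have hc : ∀ w ∈ A, ∀ y, w (u y) = u (w y) := fun w hw y =>
      LinearMap.congr_fun (hcomm w (Finset.mem_insert_of_mem hw) u (Finset.mem_insert_self _ _)) y
    have h1 : x + u x ∈ {x : V | ∀ w ∈ insert u A, w x = x ∨ w x = -x} := by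
      intro w hw
      rcases Finset.mem_insert.1 hw with rfl | hw
      · left; rw [map_add, huu, add_comm]
      · rcases hx w hw with h | h
        · left; rw [map_add, hc w hw, h]
        · right; rw [map_add, hc w hw, h, map_neg]; abel
    have h1' : x - u x ∈ {x : V | ∀ w ∈ insert u A, w x = x ∨ w x = -x} := by
      intro w hw
      rcases Finset.mem_insert.1 hw with rfl | hw
      · right; rw [map_sub, huu, neg_sub]
      · rcases hx w hw with h | h
        · left; rw [map_sub, hc w hw, h]
        · right; rw [map_sub, hc w hw, h, map_neg]; abel
    have h3 : x = (2 : R)⁻¹ • ((x + u x) + (x - u x)) := by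
      rw [add_add_sub_cancel, ← two_smul R x, smul_smul, inv_mul_cancel₀ h2, one_smul]
    rw [h3]
    exact Submodule.smul_mem _ _
      (Submodule.add_mem _ (Submodule.subset_span h1) (Submodule.subset_span h1'))

/-- Finitely many commuting involutions are simultaneously diagonalizable. -/
theorem exists_basis_diag [FiniteDimensional R V] (h2 : (2 : R) ≠ 0)
    (hι : Fintype.card ι = finrank R V) (A : Finset (End R V))
    (hinv : ∀ u ∈ A, u * u = 1) (hcomm : ∀ u ∈ A, ∀ w ∈ A, u * w = w * u) :
    ∃ b : Basis ι R V, ∀ u ∈ A, ∃ S : Finset ι, u = diag b S := by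
  obtain ⟨B, hBs, hspan, hli⟩ := exists_linearIndependent R
    {x : V | ∀ u ∈ A, u x = x ∨ u x = -x}
  rw [span_common_eigenvectors h2 A hinv hcomm] at hspan
  let b₀ : Basis B R V := Basis.mk hli (by rw [Subtype.range_coe]; exact hspan.ge)
  have : Finite B := hli.finite
  have : Fintype B := Fintype.ofFinite B
  have e : B ≃ ι := Fintype.equivOfCardEq (by rw [hι, finrank_eq_card_basis b₀])
  refine ⟨b₀.reindex e, fun u hu => ?_⟩
  classical
  refine ⟨Finset.univ.filter fun i => u (b₀.reindex e i) = b₀.reindex e i, ?_⟩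
  refine (b₀.reindex e).ext fun i => ?_
  rw [diag_apply]
  simp only [Finset.mem_filter, Finset.mem_univ, true_and]
  split_ifs with h
  · exact h
  · have hmem := hBs (e.symm i).2 u hu
    have : (b₀.reindex e) i = (e.symm i : V) := by simp [b₀]
    rw [← this] at hmem
    exact hmem.resolve_left h

end Diagonal

/-! ### Images of frames -/

section Frames

open Module

variable {R : Type*} [DivisionRing R] {V : Type*} [AddCommGroup V] [Module R V]
variable {ι : Type*}

/-- The basis obtained from `b` by adding `c • b i` to `b j`. -/
noncomputable def addMul (b : Basis ι R V) {i j : ι} (hij : i ≠ j) (c : R) : Basis ι R V :=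
  b.map (LinearEquiv.transvection (f := b.coord j) (v := c • b i) (by simp [hij]))

theorem addMul_apply_self (b : Basis ι R V) {i j : ι} (hij : i ≠ j) (c : R) :
    addMul b hij c j = b j + c • b i := by
  simp [addMul, LinearMap.transvection.apply]

theorem addMul_apply_of_ne (b : Basis ι R V) {i j l : ι} (hij : i ≠ j) (c : R) (hl : l ≠ j) :
    addMul b hij c l = b l := by
  simp [addMul, LinearMap.transvection.apply, hl]

variable [DecidableEq ι]

theorem diag_addMul (b : Basis ι R V) {i j : ι} (hij : i ≠ j) (c : R) {S : Finset ι}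
    (hS : i ∈ S ↔ j ∈ S) : diag (addMul b hij c) S = diag b S := by
  refine (addMul b hij c).ext fun l => ?_
  rw [diag_apply]
  by_cases hl : l = j
  · subst hl
    rw [addMul_apply_self, map_add, map_smul, diag_apply, diag_apply]
    by_cases h : i ∈ S
    · simp [h, hS.1 h]
    · have := mt hS.2 h
      simp [h, this]; abel
  · rw [addMul_apply_of_ne b hij c hl, diag_apply]

variable [Fintype ι] {k : ℕ}

/-- The `(k, k)`-involution `diag b S`. -/
noncomputable def diagInv (h2 : (2 : R) ≠ 0) (hι : Fintype.card ι = 2 * k) (b : Basis ι R V)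
    (S : {S : Finset ι // S.card = k}) : involutions R V k k :=
  ⟨diagGL b S.1, diagGL_mem_involutions h2 hι b S.2⟩

theorem coe_diagInv (h2 : (2 : R) ≠ 0) (hι : Fintype.card ι = 2 * k) (b : Basis ι R V)
    (S : {S : Finset ι // S.card = k}) :
    ((diagInv h2 hι b S : LinearMap.GeneralLinearGroup R V) : End R V) = diag b S.1 := rfl

theorem coe_injective_involutions : Function.Injective
    (fun u : involutions R V k k => ((u : LinearMap.GeneralLinearGroup R V) : End R V)) :=
  fun _ _ h => Subtype.ext (Units.ext h)

theorem diagInv_injective (h2 : (2 : R) ≠ 0) (hι : Fintype.card ι = 2 * k) (b : Basis ι R V) :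
    Function.Injective (diagInv h2 hι b) := by
  intro S T h
  exact Subtype.ext (diag_injective h2 b (congrArg
    (fun u : involutions R V k k => ((u : LinearMap.GeneralLinearGroup R V) : End R V)) h))

theorem commute_iff_coe {u v : LinearMap.GeneralLinearGroup R V} :
    Commute u v ↔ (u : End R V) * v = v * u := by
  rw [commute_iff_eq, ← Units.val_inj, Units.val_mul, Units.val_mul]

/-- A family of involutions diagonal in a basis `b` fails to separate two vectors of `b` if and
only if some `(k, k)`-involution commutes with this family, but not with all the
`(k, k)`-involutions diagonal in `b`; so a commutativity preserving bijection which
maps the involutions diagonal in `b` to those diagonal in `b'` respects such families. -/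
theorem nonseparating_of_commutativityPreserving (h2 : (2 : R) ≠ 0)
    (hι : Fintype.card ι = 2 * k) (hk : 2 ≤ k)
    {f : involutions R V k k ≃ involutions R V k k} (hf : CommutativityPreserving f)
    {b b' : Basis ι R V} (φ : {S : Finset ι // S.card = k} ≃ {S : Finset ι // S.card = k})
    (hφ : ∀ S, f (diagInv h2 hι b S) = diagInv h2 hι b' (φ S))
    (Y : Set {S : Finset ι // S.card = k})
    (hY : ∃ i j : ι, i ≠ j ∧ ∀ S ∈ Y, (i ∈ S.1 ↔ j ∈ S.1)) :
    ∃ i j : ι, i ≠ j ∧ ∀ S ∈ Y, (i ∈ (φ S).1 ↔ j ∈ (φ S).1) := by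
  obtain ⟨i, j, hij, hY⟩ := hY
  by_contra! hcon
  obtain ⟨T, hT, hiT, hjT⟩ := exists_card_eq_subset_disjoint hι {i} {j} (by simpa using hij)
    (by simp; omega) (by simp; omega)
  rw [Finset.singleton_subset_iff] at hiT
  rw [Finset.disjoint_singleton_left] at hjT
  -- `v` is diagonal in a basis that differs from `b` only in the plane of `b i` and `b j`.
  let v := diagInv h2 hι (addMul b hij 1) ⟨T, hT⟩
  have hv : ∀ S ∈ Y, Commute (v : LinearMap.GeneralLinearGroup R V) (diagInv h2 hι b S) := by
    intro S hS
    rw [commute_iff_coe, coe_diagInv, coe_diagInv, ← diag_addMul b hij 1 (hY S hS)]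
    exact diag_comm _ _ _
  have hfv : ∀ S' : {S : Finset ι // S.card = k},
      Commute (f v : LinearMap.GeneralLinearGroup R V) (diagInv h2 hι b' S') := by
    intro S'
    rw [commute_iff_coe, coe_diagInv]
    refine commute_diag_of_separating h2 b' (Y := {S | ∃ S₀ ∈ Y, S = (φ S₀).1}) ?_ ?_ S'.1
    · intro a c hac
      obtain ⟨S, hS, h⟩ := hcon a c hac
      refine ⟨_, ⟨S, hS, rfl⟩, ?_⟩
      tauto
    · rintro _ ⟨S, hS, rfl⟩
      have := hf.1 _ _ (hv S hS)
      rwa [hφ, commute_iff_coe, coe_diagInv] at this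
  have hvT := hf.2 _ _ (hfv (φ ⟨T, hT⟩))
  rw [← hφ, Equiv.symm_apply_apply, Equiv.symm_apply_apply, commute_iff_coe, coe_diagInv,
    coe_diagInv] at hvT
  have h0 := repr_eq_zero_of_commute h2 b (i := j) (j := i) (by tauto) hvT
  -- But `v` has a nonzero matrix entry at `(j, i)`.
  have hvj : diag (addMul b hij 1) T (b j) = -b j - (2 : R) • b i := by
    have e1 : b j = addMul b hij 1 j - addMul b hij 1 i := by
      rw [addMul_apply_self, addMul_apply_of_ne b hij 1 hij]; simp
    conv_lhs => rw [e1]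
    rw [map_sub, diag_apply, diag_apply, if_neg hjT, if_pos hiT, addMul_apply_self,
      addMul_apply_of_ne b hij 1 hij, one_smul, two_smul]
    abel
  rw [hvj] at h0
  simp [hij] at h0
  exact h2 h0

/-- The basis `b'` describes the image of the frame of `b`: up to sign, `f` maps the involutions
diagonal in `b` to the involutions diagonal in `b'` with the same index set. -/
def IsImage (f : involutions R V k k ≃ involutions R V k k) (b b' : Basis ι R V) : Prop :=
  ∀ (u : involutions R V k k) (S : Finset ι), S.card = k →
    ((u : LinearMap.GeneralLinearGroup R V) : End R V) = diag b S →
    ((f u : LinearMap.GeneralLinearGroup R V) : End R V) = diag b' S ∨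
    ((f u : LinearMap.GeneralLinearGroup R V) : End R V) = -diag b' S

/-- Finitely many commuting `(k, k)`-involutions are diagonal in a common basis. -/
theorem exists_diagInv_eq [FiniteDimensional R V] (h2 : (2 : R) ≠ 0)
    (hι : Fintype.card ι = 2 * k) (hV : finrank R V = 2 * k) {A : Finset (involutions R V k k)}
    (hA : ∀ u ∈ A, ∀ w ∈ A, Commute (u : LinearMap.GeneralLinearGroup R V) w) :
    ∃ b : Basis ι R V, ∀ u ∈ A, ∃ S, u = diagInv h2 hι b S := by
  classical
  obtain ⟨b, hb⟩ := exists_basis_diag h2 (hι.trans hV.symm)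
    (A.image fun u : involutions R V k k => ((u : LinearMap.GeneralLinearGroup R V) : End R V))
    (by
      simp only [Finset.mem_image]
      rintro _ ⟨u, hu, rfl⟩
      rw [← Units.val_mul, u.2.1, Units.val_one])
    (by
      simp only [Finset.mem_image]
      rintro _ ⟨u, hu, rfl⟩ _ ⟨w, hw, rfl⟩
      exact commute_iff_coe.1 (hA u hu w hw))
  refine ⟨b, fun u hu => ?_⟩
  obtain ⟨S, hS⟩ := hb _ (Finset.mem_image_of_mem _ hu)
  have hcard : S.card = k := by
    rw [← finrank_ker_diag_sub_id h2 b S, ← hS]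
    exact u.2.2.1
  exact ⟨⟨S, hcard⟩, coe_injective_involutions hS⟩

/-- Every frame has an image frame. The involutions of `b` go to those of a basis `b₀` by counting;
the resulting permutation of the `k`-subsets comes, up to complements, from a permutation of the
indices, by which `b₀` is renumbered. -/
theorem exists_isImage [FiniteDimensional R V] (h2 : (2 : R) ≠ 0)
    (hι : Fintype.card ι = 2 * k) (hk : 4 ≤ k) (hV : finrank R V = 2 * k)
    {f : involutions R V k k ≃ involutions R V k k} (hf : CommutativityPreserving f)
    (b : Basis ι R V) : ∃ b' : Basis ι R V, IsImage f b b' := by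
  classical
  obtain ⟨b₀, hb₀⟩ := exists_diagInv_eq h2 hι hV
    (A := Finset.univ.image fun S => f (diagInv h2 hι b S)) (by
      simp only [Finset.mem_image, Finset.mem_univ, true_and]
      rintro _ ⟨S, rfl⟩ _ ⟨T, rfl⟩
      exact hf.1 _ _ (commute_iff_coe.2 (diag_comm b S.1 T.1)))
  have hb₀ := fun S => hb₀ _ (Finset.mem_image_of_mem _ (Finset.mem_univ S))
  choose τ hτ using hb₀
  -- An injective self-map of the finite set of `k`-subsets is a permutation.
  have hτinj : Function.Injective τ := by
    intro S T h
    have : f (diagInv h2 hι b S) = f (diagInv h2 hι b T) := by rw [hτ, hτ, h]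
    exact diagInv_injective h2 hι b (f.injective this)
  let φ := Equiv.ofBijective τ hτinj.bijective_of_finite
  have hφ : ∀ S, f (diagInv h2 hι b S) = diagInv h2 hι b₀ (φ S) := hτ
  obtain ⟨σ, hσ⟩ := exists_perm_of_preserves_nonseparating hk hι φ
    (nonseparating_of_commutativityPreserving h2 hι (by omega) hf φ hφ)
    (nonseparating_of_commutativityPreserving h2 hι (by omega) (f := f.symm) ⟨hf.2, hf.1⟩ φ.symm
      fun S => by rw [Equiv.symm_apply_eq, hφ, Equiv.apply_symm_apply])
  refine ⟨b₀.reindex σ.symm, fun u S hS hu => ?_⟩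
  have hu' : u = diagInv h2 hι b ⟨S, hS⟩ := coe_injective_involutions hu
  rw [hu', hφ, coe_diagInv]
  rcases hσ ⟨S, hS⟩ with h | h
  · left
    refine (b₀.reindex σ.symm).ext fun i => ?_
    rw [diag_apply, Basis.reindex_apply, diag_apply, Equiv.symm_symm]
    simp [h i]
  · right
    refine (b₀.reindex σ.symm).ext fun i => ?_
    rw [LinearMap.neg_apply, diag_apply, Basis.reindex_apply, diag_apply, Equiv.symm_symm]
    by_cases hi : i ∈ S <;> simp [h i, hi]

end Frames

/-! ### Connecting frames by elementary moves -/

section Moves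

open Module

variable {R : Type*} [DivisionRing R] {V : Type*} [AddCommGroup V] [Module R V]
variable {ι : Type*}

/-- The projection onto the line of `b i` along the other vectors of the basis `b`. -/
noncomputable def proj (b : Basis ι R V) (i : ι) : End R V :=
  LinearMap.toSpanSingleton R V (b i) ∘ₗ b.coord i

theorem proj_apply (b : Basis ι R V) (i : ι) (v : V) : proj b i v = b.repr v i • b i := rfl

theorem proj_apply_self (b : Basis ι R V) (i : ι) : proj b i (b i) = b i := by
  simp [proj_apply]

theorem proj_apply_of_ne (b : Basis ι R V) {i j : ι} (h : j ≠ i) : proj b i (b j) = 0 := by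
  simp [proj_apply, h]

variable [DecidableEq ι]

theorem exists_add_sum_of_forall_addMul {P : Basis ι R V → Prop} {o : ι}
    (hadd : ∀ (b : Basis ι R V) (i j : ι) (hij : i ≠ j) (c : R), i ≠ o → j ≠ o → P b →
      P (addMul b hij c))
    {b : Basis ι R V} (hb : P b) {j : ι} (hj : j ≠ o) (a : ι → R) (F : Finset ι)
    (hoF : o ∉ F) (hjF : j ∉ F) :
    ∃ b' : Basis ι R V, P b' ∧ b' j = b j + ∑ i ∈ F, a i • b i ∧ ∀ m, m ≠ j → b' m = b m := by
  induction F using Finset.induction_on with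
  | empty => exact ⟨b, hb, by simp, fun _ _ => rfl⟩
  | insert x F hx ih =>
    simp only [Finset.mem_insert, not_or] at hoF hjF
    obtain ⟨b', hb', h1, h2⟩ := ih hoF.2 hjF.2
    have hxj : x ≠ j := Ne.symm hjF.1
    refine ⟨addMul b' hxj (a x), hadd _ _ _ _ _ (Ne.symm hoF.1) hj hb', ?_, fun m hm => ?_⟩
    · rw [addMul_apply_self, h1, h2 x hxj, Finset.sum_insert hx]
      abel
    · rw [addMul_apply_of_ne _ _ _ hm, h2 m hm]

variable [Fintype ι]

/-- By the moves under consideration, `b j` can be replaced by any vector with a nonzero coordinate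
at `j` and coordinate zero at `o`. -/
theorem exists_update_of_forall_addMul {P : Basis ι R V → Prop} {o : ι}
    (hadd : ∀ (b : Basis ι R V) (i j : ι) (hij : i ≠ j) (c : R), i ≠ o → j ≠ o → P b →
      P (addMul b hij c))
    (hsmul : ∀ (b : Basis ι R V) (w : ι → Rˣ), P b → P (b.unitsSMul w))
    {b : Basis ι R V} (hb : P b) {j : ι} (hj : j ≠ o) (v : V) (hvo : b.repr v o = 0)
    (hvj : b.repr v j ≠ 0) :
    ∃ b' : Basis ι R V, P b' ∧ b' j = v ∧ ∀ m, m ≠ j → b' m = b m := by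
  obtain ⟨b', hb', h1, h2⟩ := exists_add_sum_of_forall_addMul hadd
    (hsmul b (Function.update 1 j (Units.mk0 _ hvj)) hb) hj (b.repr v) (Finset.univ \ {o, j})
    (by simp) (by simp)
  refine ⟨b', hb', ?_, fun m hm => ?_⟩
  · rw [h1, Basis.unitsSMul_apply, Function.update_self]
    have e : ∀ i ∈ Finset.univ \ {o, j},
        b.repr v i • (b.unitsSMul (Function.update 1 j (Units.mk0 _ hvj))) i
          = b.repr v i • b i := by
      intro i hi
      simp only [Finset.mem_sdiff, Finset.mem_univ, Finset.mem_insert, Finset.mem_singleton,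
        true_and, not_or] at hi
      rw [Basis.unitsSMul_apply, Function.update_of_ne hi.2]
      simp
    rw [Finset.sum_congr rfl e]
    conv_rhs => rw [← b.sum_repr v]
    rw [← Finset.sum_sdiff (Finset.subset_univ {o, j}), Finset.sum_pair (Ne.symm hj), hvo,
      zero_smul, zero_add, add_comm]
    rfl
  · rw [h2 m hm, Basis.unitsSMul_apply, Function.update_of_ne hm]
    simp

/-- A property of bases that is preserved by rescaling the basis vectors and by adding multiples of
basis vectors to each other, the vector number `o` excepted, passes from `b` to every basis with
the same vector number `o` and the same span of the others. -/
theorem of_forall_addMul {P : Basis ι R V → Prop} {o : ι}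
    (hadd : ∀ (b : Basis ι R V) (i j : ι) (hij : i ≠ j) (c : R), i ≠ o → j ≠ o → P b →
      P (addMul b hij c))
    (hsmul : ∀ (b : Basis ι R V) (w : ι → Rˣ), P b → P (b.unitsSMul w))
    {b b₂ : Basis ι R V} (hb : P b) (ho : b o = b₂ o)
    (hker : ∀ i, i ≠ o → b₂.repr (b i) o = 0) : P b₂ := by
  -- Make `b` agree with `b₂` on a growing set `M` of indices.
  suffices H : ∀ (N : ℕ) (M : Finset ι), Mᶜ.card = N → o ∈ M → ∀ b : Basis ι R V, P b →
      (∀ m ∈ M, b m = b₂ m) → (∀ i, i ≠ o → b₂.repr (b i) o = 0) → P b₂ from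
    H _ {o} rfl (by simp) b hb (by simpa using ho) hker
  intro N
  induction N with
  | zero =>
    intro M hM _ b hb hag _
    have hM : M = Finset.univ := by simpa using hM
    have : b = b₂ := Basis.eq_of_apply_eq fun i => hag i (by simp [hM])
    rwa [← this]
  | succ N ih =>
    intro M hM hoM b hb hag hker
    obtain ⟨m₀, hm₀⟩ : Mᶜ.Nonempty := Finset.card_pos.1 (by omega)
    have hm₀M : m₀ ∉ M := by simpa using hm₀
    have hm₀o : m₀ ≠ o := by rintro rfl; exact hm₀M hoM
    set v := b₂ m₀ with hv
    have hrepr : ∀ b : Basis ι R V, b o = b₂ o → (∀ i, i ≠ o → b₂.repr (b i) o = 0) →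
        b.repr v o = 0 := by
      intro b hbo hker
      have h := congrArg (b₂.coord o) (b.sum_repr v)
      rw [map_sum, Finset.sum_eq_single_of_mem o (Finset.mem_univ _)
        (fun i _ hi => by simp [hker i hi])] at h
      simpa [hbo, hv, hm₀o] using h
    -- It suffices to treat the case of a nonzero coordinate of `v` at `m₀`.
    have key : ∀ b : Basis ι R V, P b → (∀ m ∈ M, b m = b₂ m) →
        (∀ i, i ≠ o → b₂.repr (b i) o = 0) → b.repr v m₀ ≠ 0 → P b₂ := by
      intro b hb hag hker hne
      obtain ⟨b', hb', h1, h2⟩ := exists_update_of_forall_addMul hadd hsmul hb hm₀o v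
        (hrepr b (hag o hoM) hker) hne
      refine ih (insert m₀ M) ?_ (Finset.mem_insert_of_mem hoM) b' hb' ?_ ?_
      · rw [Finset.card_compl, Finset.card_insert_of_notMem hm₀M]
        rw [Finset.card_compl] at hM
        omega
      · intro m hm
        rcases Finset.mem_insert.1 hm with rfl | hm'
        · exact h1
        · rw [h2 m (by rintro rfl; exact hm₀M hm'), hag m hm']
      · intro i hi
        by_cases him : i = m₀
        · rw [him, h1, hv]; simp [hm₀o]
        · rw [h2 i him, hker i hi]
    by_cases hne : b.repr v m₀ = 0
    · obtain ⟨i, hiM, hi⟩ : ∃ i, i ∉ M ∧ b.repr v i ≠ 0 := by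
        by_contra! hcon
        have h := congrArg (fun x => b₂.repr x m₀) (b.sum_repr v)
        simp only [map_sum, map_smul, Finsupp.coe_finsetSum, Finset.sum_apply,
          Finsupp.smul_apply] at h
        rw [Finset.sum_eq_zero] at h
        · simp [hv] at h
        · intro i _
          by_cases hiM : i ∈ M
          · have : i ≠ m₀ := by rintro rfl; exact hm₀M hiM
            simp [hag i hiM, this]
          · simp [hcon i hiM]
      -- Subtracting `b m₀` from `b i` moves the coordinate of `v` at `i` to `m₀` as well.
      have him : m₀ ≠ i := by rintro rfl; exact hi hne
      have hio : i ≠ o := by rintro rfl; exact hiM hoM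
      refine key (addMul b him (-1)) (hadd _ _ _ _ _ hm₀o hio hb) ?_ ?_ ?_
      · intro m hm
        rw [addMul_apply_of_ne _ _ _ (by rintro rfl; exact hiM hm), hag m hm]
      · intro m hm
        by_cases hmi : m = i
        · subst hmi
          rw [addMul_apply_self]
          simp [hker m hm, hker m₀ hm₀o]
        · rw [addMul_apply_of_ne _ _ _ hmi, hker m hm]
      · have : (addMul b him (-1)).coord m₀ = b.coord m₀ + b.coord i := by
          refine (addMul b him (-1)).ext fun l => ?_
          by_cases hli : l = i
          · subst hli
            rw [Basis.coord_apply, Basis.repr_self, addMul_apply_self]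
            simp [him, him.symm]
          · rw [Basis.coord_apply, Basis.repr_self, addMul_apply_of_ne _ _ _ hli]
            by_cases hlm : l = m₀
            · subst hlm; simp [him]
            · simp [hli, hlm]
        have h := LinearMap.congr_fun this v
        simp only [Basis.coord_apply, LinearMap.add_apply, hne, zero_add] at h
        rw [h]
        exact hi
    · exact key b hb hag hker hne

/-! ### The induced map on projections of rank one -/

theorem diag_mul_diag (b : Basis ι R V) (S T : Finset ι) :
    diag b S * diag b T = diag b (symmDiff S T)ᶜ := by
  refine b.ext fun i => ?_
  by_cases hi : i ∈ S <;> by_cases hj : i ∈ T <;>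
    simp [diag_apply, hi, hj]

/-- Involutions with a two-dimensional `-1`-space determine the projections of a frame. -/
theorem one_sub_diag_mul_one_sub_diag (b : Basis ι R V) {l m m' : ι} (h : m ≠ m') :
    (1 - diag b {l, m}ᶜ) * (1 - diag b {l, m'}ᶜ) = (4 : ℕ) • proj b l := by
  refine b.ext fun i => ?_
  rw [Module.End.mul_apply, LinearMap.smul_apply, LinearMap.sub_apply 1 (diag b {l, m'}ᶜ),
    diag_apply]
  by_cases hl : i = l
  · subst hl
    simp [diag_apply, proj_apply]
    abel
  · rw [proj_apply_of_ne _ hl]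
    by_cases hm : i = m'
    · subst hm
      simp [diag_apply, hl, h.symm]
    · simp [hl, hm]

variable {k : ℕ}

/-- If two bases give the same involutions for all index sets not separating `i` from `j`, then
their image frames have the same projections, except possibly those number `i` and `j`. -/
theorem IsImage.proj_eq_of_diag_eq (h2 : (2 : R) ≠ 0) (hι : Fintype.card ι = 2 * k) (hk : 4 ≤ k)
    {f : involutions R V k k ≃ involutions R V k k} {b c b' c' : Basis ι R V}
    (hb : IsImage f b b') (hc : IsImage f c c') {i j l : ι}
    (h : ∀ S : Finset ι, (i ∈ S ↔ j ∈ S) → diag b S = diag c S) (hli : l ≠ i) (hlj : l ≠ j) :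
    proj b' l = proj c' l := by
  have hpm : ∀ S : Finset ι, S.card = k → (i ∈ S ↔ j ∈ S) →
      diag b' S = diag c' S ∨ diag b' S = -diag c' S := by
    intro S hS hij
    have h1 := hb (diagInv h2 hι b ⟨S, hS⟩) S hS rfl
    have h1' := hc (diagInv h2 hι b ⟨S, hS⟩) S hS (h S hij)
    rcases h1 with h1 | h1 <;> rcases h1' with h1' | h1' <;> rw [h1] at h1'
    · exact Or.inl h1'
    · exact Or.inr h1'
    · exact Or.inr (neg_eq_iff_eq_neg.1 h1')
    · exact Or.inl (neg_injective h1')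
  -- Multiplying two involutions whose index sets differ by exchanging `l` and `m` cancels the rest.
  have hpair : ∀ m, m ≠ l → m ≠ i → m ≠ j → diag b' {l, m}ᶜ = diag c' {l, m}ᶜ := by
    intro m hml hmi hmj
    obtain ⟨S, hS, hlS, hdisj⟩ := exists_card_eq_subset_disjoint hι {l} {m, i, j}
      (by simp [hml.symm, hli, hlj]) (by simp; omega)
      (Finset.card_le_three.trans (by omega))
    rw [Finset.singleton_subset_iff] at hlS
    simp only [Finset.disjoint_insert_left, Finset.disjoint_singleton_left] at hdisj
    obtain ⟨hmS, hiS, hjS⟩ := hdisj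
    have e : symmDiff S (insert m (S.erase l)) = {l, m} := by
      ext x
      simp only [Finset.mem_symmDiff, Finset.mem_insert, Finset.mem_erase, Finset.mem_singleton]
      by_cases hxl : x = l <;> by_cases hxm : x = m <;> by_cases hxS : x ∈ S <;> simp_all
    have h1 := hpm S hS (by simp [hiS, hjS])
    have h3 := hpm (insert m (S.erase l))
      (by rw [Finset.card_insert_of_notMem (by simp [hmS]), Finset.card_erase_of_mem hlS]; omega)
      (by simp [hiS, hjS, hmi.symm, hmj.symm])
    have hprod : diag b' {l, m}ᶜ = diag c' {l, m}ᶜ ∨ diag b' {l, m}ᶜ = -diag c' {l, m}ᶜ := by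
      rw [← e, ← diag_mul_diag, ← diag_mul_diag]
      rcases h1 with h1 | h1 <;> rcases h3 with h3 | h3 <;> rw [h1, h3] <;> simp
    refine hprod.resolve_right fun hneg => ?_
    -- The two sides of `hneg` have fixed spaces of dimensions `2k - 2` and `2`.
    have hd := finrank_ker_diag_sub_id h2 b' {l, m}ᶜ
    rw [hneg, neg_diag, compl_compl, finrank_ker_diag_sub_id h2, Finset.card_compl,
      Finset.card_pair hml.symm] at hd
    omega
  obtain ⟨m, hm⟩ := exists_ne_of_card (m := 3) (by omega) {l, i, j} Finset.card_le_three
  obtain ⟨m', hm'⟩ := exists_ne_of_card (m := 4) (by omega) {m, l, i, j} Finset.card_le_four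
  simp only [Finset.mem_insert, Finset.mem_singleton, not_or] at hm hm'
  have h4 : (4 : ℕ) • proj b' l = (4 : ℕ) • proj c' l := by
    rw [← one_sub_diag_mul_one_sub_diag b' (Ne.symm hm'.1),
      ← one_sub_diag_mul_one_sub_diag c' (Ne.symm hm'.1),
      hpair m hm.1 hm.2.1 hm.2.2, hpair m' hm'.2.1 hm'.2.2.1 hm'.2.2.2]
  have h4' : (4 : R) ≠ 0 := by
    rw [show (4 : R) = 2 * 2 by norm_num]
    exact mul_ne_zero h2 h2
  ext v
  have hv := LinearMap.congr_fun h4 v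
  rw [LinearMap.smul_apply, LinearMap.smul_apply, ← Nat.cast_smul_eq_nsmul R,
    ← Nat.cast_smul_eq_nsmul R] at hv
  exact smul_right_injective V (by exact_mod_cast h4') hv

omit [Fintype ι] in
theorem diag_unitsSMul (b : Basis ι R V) (w : ι → Rˣ) (S : Finset ι) :
    diag (b.unitsSMul w) S = diag b S := by
  refine (b.unitsSMul w).ext fun i => ?_
  rw [diag_apply, Basis.unitsSMul_apply, Units.smul_def, map_smul, diag_apply]
  split_ifs <;> simp

omit [Fintype ι] in
theorem diag_reindex (b : Basis ι R V) (e : Equiv.Perm ι) (S : Finset ι) :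
    diag (b.reindex e) S = diag b (S.map e.symm.toEmbedding) := by
  refine (b.reindex e).ext fun i => ?_
  rw [diag_apply, Basis.reindex_apply, diag_apply]
  simp

omit [DecidableEq ι] [Fintype ι] in
theorem proj_reindex (b : Basis ι R V) (e : Equiv.Perm ι) (i : ι) :
    proj (b.reindex e) i = proj b (e.symm i) := by
  ext v
  simp [proj_apply]

omit [Fintype ι] in
theorem IsImage.reindex {f : involutions R V k k ≃ involutions R V k k} {b b' : Basis ι R V}
    (h : IsImage f b b') (e : Equiv.Perm ι) : IsImage f (b.reindex e) (b'.reindex e) := by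
  intro u S hS hu
  rw [diag_reindex] at hu ⊢
  exact h u _ (by rw [Finset.card_map, hS]) hu

theorem IsImage.symm (h2 : (2 : R) ≠ 0) (hι : Fintype.card ι = 2 * k) (hk : 0 < k)
    {f : involutions R V k k ≃ involutions R V k k} {b b' : Basis ι R V}
    (h : IsImage f b b') : IsImage f.symm b' b := by
  intro u S hS hu
  have hSc : Sᶜ.card = k := by rw [Finset.card_compl]; omega
  have h1 := h (diagInv h2 hι b ⟨S, hS⟩) S hS rfl
  have h3 := h (diagInv h2 hι b ⟨Sᶜ, hSc⟩) Sᶜ hSc rfl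
  rw [← neg_diag, neg_neg] at h3
  -- `f` permutes the two involutions `± diag b S` onto `± diag b' S`.
  rcases h1 with h1 | h1
  · left
    rw [← coe_diagInv h2 hι b ⟨S, hS⟩, (Equiv.symm_apply_eq f).2
      (coe_injective_involutions (hu.trans h1.symm))]
  rcases h3 with h3 | h3
  · have he := diagInv_injective h2 hι b
      (f.injective (coe_injective_involutions (h1.trans h3.symm)))
    obtain ⟨x, hx⟩ : S.Nonempty := Finset.card_pos.1 (by omega)
    have e : S = Sᶜ := Subtype.ext_iff.1 he
    have hx' : x ∈ Sᶜ := by rwa [← e]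
    exact absurd hx (Finset.mem_compl.1 hx')
  · right
    rw [neg_diag, ← coe_diagInv h2 hι b ⟨Sᶜ, hSc⟩, (Equiv.symm_apply_eq f).2
      (coe_injective_involutions (hu.trans h3.symm))]

/-- A projection that belongs to two frames has the same image for both: the frames are connected
by elementary moves, and each move leaves the image unchanged. -/
theorem IsImage.proj_eq_of_proj_eq [FiniteDimensional R V] (h2 : (2 : R) ≠ 0)
    (hι : Fintype.card ι = 2 * k) (hk : 4 ≤ k) (hV : finrank R V = 2 * k)
    {f : involutions R V k k ≃ involutions R V k k} (hf : CommutativityPreserving f)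
    {b c b' c' : Basis ι R V} (hb : IsImage f b b') (hc : IsImage f c c') {o o' : ι}
    (h : proj b o = proj c o') : proj b' o = proj c' o' := by
  -- Renumbering reduces the claim to the case `o = o'`.
  suffices H : ∀ {c c' : Basis ι R V}, IsImage f c c' → proj b o = proj c o →
      proj b' o = proj c' o by
    have := H (hc.reindex (Equiv.swap o' o)) (by rw [h, proj_reindex]; simp)
    rw [this, proj_reindex]
    simp
  clear h hc
  intro c c' hc h
  obtain ⟨i, hi⟩ := exists_ne_of_card (m := 1) (by omega) {o} (by simp)
  obtain ⟨j, hj⟩ := exists_ne_of_card (m := 2) (by omega) {o, i} Finset.card_le_two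
  simp only [Finset.mem_insert, Finset.mem_singleton, not_or] at hi hj
  have hscale : ∀ (b : Basis ι R V) (w : ι → Rˣ),
      (∀ b₁, IsImage f b b₁ → proj b₁ o = proj b' o) →
      ∀ b₁, IsImage f (b.unitsSMul w) b₁ → proj b₁ o = proj b' o := by
    intro b w hP b₁ hb₁
    obtain ⟨b₂, hb₂⟩ := exists_isImage h2 hι hk hV hf b
    rw [← hP b₂ hb₂]
    exact hb₁.proj_eq_of_diag_eq h2 hι hk hb₂ (i := i) (j := j)
      (fun S _ => diag_unitsSMul b w S) (Ne.symm hi) (Ne.symm hj.1)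
  have hb0 : ∀ b₁, IsImage f b b₁ → proj b₁ o = proj b' o := fun b₁ hb₁ =>
    hb₁.proj_eq_of_diag_eq h2 hι hk hb (i := i) (j := j) (fun _ _ => rfl)
      (Ne.symm hi) (Ne.symm hj.1)
  have hco : b.repr (c o) o • b o = c o := by
    rw [← proj_apply, h, proj_apply_self]
  have hne : b.repr (c o) o ≠ 0 := by
    intro h0
    rw [h0, zero_smul] at hco
    exact c.ne_zero o hco.symm
  have hfin := of_forall_addMul (P := fun b => ∀ b₁, IsImage f b b₁ → proj b₁ o = proj b' o)
    (o := o) ?_ hscale (hscale b (Function.update 1 o (Units.mk0 _ hne)) hb0) (b₂ := c) ?_ ?_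
  · exact (hfin c' hc).symm
  · intro b i j hij a hi hj hP b₁ hb₁
    obtain ⟨b₂, hb₂⟩ := exists_isImage h2 hι hk hV hf b
    rw [← hP b₂ hb₂]
    exact hb₁.proj_eq_of_diag_eq h2 hι hk hb₂ (fun S hS => diag_addMul b hij a hS)
      (Ne.symm hi) (Ne.symm hj)
  · rw [Basis.unitsSMul_apply, Function.update_self]
    exact hco
  · intro i hi
    have : proj c o (b i) = 0 := by rw [← h, proj_apply_of_ne b hi]
    rw [proj_apply, smul_eq_zero] at this
    have := this.resolve_right (c.ne_zero o)
    rw [Basis.unitsSMul_apply, Function.update_of_ne hi]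
    simpa using this

variable (R V) in
/-- The set of projections of `V` onto a line, `v ↦ φ v • x` with `φ x = 1`. -/
def lineProjections : Set (End R V) :=
  {p | ∃ (x : V) (φ : V →ₗ[R] R), φ x = 1 ∧ p = LinearMap.toSpanSingleton R V x ∘ₗ φ}

omit [DecidableEq ι] [Fintype ι] in
theorem proj_mem_lineProjections (b : Basis ι R V) (i : ι) : proj b i ∈ lineProjections R V :=
  ⟨b i, b.coord i, by simp, rfl⟩

theorem lineProjections_mul_self {p : End R V} (hp : p ∈ lineProjections R V) : p * p = p := by
  obtain ⟨x, φ, h, rfl⟩ := hp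
  ext v
  simp [h]

omit [DecidableEq ι] [Fintype ι] in
/-- A line projection that is diagonal in a basis is one of the projections of this basis. -/
theorem exists_eq_proj {p : End R V} (hp : p ∈ lineProjections R V) {b : Basis ι R V}
    (h : ∀ i, p (b i) = 0 ∨ p (b i) = b i) : ∃ i, p = proj b i := by
  obtain ⟨x, φ, hx, rfl⟩ := hp
  have hx0 : x ≠ 0 := by rintro rfl; simp at hx
  obtain ⟨i, hi⟩ : ∃ i, φ (b i) ≠ 0 := by
    by_contra! hcon
    have : φ = 0 := b.ext fun i => by simpa using hcon i
    simp [this] at hx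
  have hbi : φ (b i) • x = b i := by
    refine (h i).resolve_left ?_
    simp [hi, hx0]
  refine ⟨i, b.ext fun j => ?_⟩
  by_cases hji : j = i
  · subst hji
    rw [proj_apply_self]
    exact hbi
  · rw [proj_apply_of_ne b hji]
    refine (h j).resolve_right fun hj => hji ?_
    have hj : φ (b j) • x = b j := hj
    by_contra hne
    -- `b i` and `b j` would be proportional to `x`.
    have e : b j = (φ (b j) * (φ (b i))⁻¹) • b i := by
      rw [← hbi, smul_smul, map_smul, smul_eq_mul, hx, mul_one, mul_assoc, inv_mul_cancel₀ hi,
        mul_one, hj]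
    have := congrArg (fun v => b.repr v j) e
    simp [Ne.symm hne] at this

/-- Two commuting line projections belong to a common frame, since the reflections `1 - 2 * p` and
`1 - 2 * q` are simultaneously diagonalizable. -/
theorem exists_basis_proj [FiniteDimensional R V] (h2 : (2 : R) ≠ 0)
    (hι : Fintype.card ι = finrank R V) {p q : End R V} (hp : p ∈ lineProjections R V)
    (hq : q ∈ lineProjections R V) (hpq : p * q = q * p) :
    ∃ (b : Basis ι R V) (i j : ι), p = proj b i ∧ q = proj b j := by
  classical
  have hinv : ∀ p ∈ lineProjections R V, (1 - 2 * p) * (1 - 2 * p) = 1 := by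
    intro p hp
    have := lineProjections_mul_self hp
    calc (1 - 2 * p) * (1 - 2 * p) = 1 - 4 * p + 4 * (p * p) := by noncomm_ring
      _ = 1 := by rw [this]; abel
  have hcomm : (1 - 2 * p) * (1 - 2 * q) = (1 - 2 * q) * (1 - 2 * p) := by
    calc (1 - 2 * p) * (1 - 2 * q) = 1 - 2 * p - 2 * q + 4 * (p * q) := by noncomm_ring
      _ = 1 - 2 * p - 2 * q + 4 * (q * p) := by rw [hpq]
      _ = (1 - 2 * q) * (1 - 2 * p) := by noncomm_ring
  obtain ⟨b, hb⟩ := exists_basis_diag (ι := ι) h2 hι {1 - 2 * p, 1 - 2 * q}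
    (by simp [hinv p hp, hinv q hq]) (by simp [hcomm])
  have key : ∀ r : End R V, (∃ S : Finset ι, 1 - 2 * r = diag b S) →
      ∀ i, r (b i) = 0 ∨ r (b i) = b i := by
    rintro r ⟨S, hS⟩ i
    have h := LinearMap.congr_fun hS (b i)
    rw [diag_apply] at h
    have e : (1 - 2 * r) (b i) = b i - (2 : R) • r (b i) := by
      rw [two_smul, two_mul, LinearMap.sub_apply, LinearMap.add_apply]; rfl
    rw [e] at h
    split_ifs at h
    · left
      simpa [h2] using h
    · right
      have : (2 : R) • r (b i) = (2 : R) • b i := by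
        rw [two_smul R (b i), ← sub_sub_cancel (b i) ((2 : R) • r (b i)), h, sub_neg_eq_add]
      exact smul_right_injective V h2 this
  obtain ⟨i, hi⟩ := exists_eq_proj hp (key p (hb _ (by simp)))
  obtain ⟨j, hj⟩ := exists_eq_proj hq (key q (hb _ (by simp)))
  exact ⟨b, i, j, hi, hj⟩

/-- A commutativity preserving bijection of the `(k, k)`-involutions induces a bijection of the
projections onto lines, which maps the projections of a frame to those of the image frame. -/
theorem exists_equiv_lineProjections [FiniteDimensional R V] (h2 : (2 : R) ≠ 0)
    (hι : Fintype.card ι = 2 * k) (hk : 4 ≤ k) (hV : finrank R V = 2 * k)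
    {f : involutions R V k k ≃ involutions R V k k} (hf : CommutativityPreserving f) :
    ∃ F : lineProjections R V ≃ lineProjections R V,
      ∀ b b' : Basis ι R V, IsImage f b b' → ∀ i,
        F ⟨proj b i, proj_mem_lineProjections b i⟩ =
          ⟨proj b' i, proj_mem_lineProjections b' i⟩ := by
  have hex : ∀ {f : involutions R V k k ≃ involutions R V k k}, CommutativityPreserving f →
      ∃ F : lineProjections R V → lineProjections R V,
      ∀ b b' : Basis ι R V, IsImage f b b' → ∀ i,
        F ⟨proj b i, proj_mem_lineProjections b i⟩ =
          ⟨proj b' i, proj_mem_lineProjections b' i⟩ := by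
    intro f hf
    have hp : ∀ p : lineProjections R V, ∃ (b b' : Basis ι R V) (i : ι), p.1 = proj b i ∧
        IsImage f b b' := by
      intro p
      obtain ⟨b, i, -, hb, -⟩ := exists_basis_proj (ι := ι) h2 (hι.trans hV.symm) p.2 p.2 rfl
      obtain ⟨b', hb'⟩ := exists_isImage h2 hι hk hV hf b
      exact ⟨b, b', i, hb, hb'⟩
    choose B B' I hB hB' using hp
    refine ⟨fun p => ⟨proj (B' p) (I p), proj_mem_lineProjections _ _⟩, fun b b' hb i => ?_⟩
    exact Subtype.ext ((hB' _).proj_eq_of_proj_eq h2 hι hk hV hf hb (hB _).symm)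
  obtain ⟨F, hF⟩ := hex hf
  obtain ⟨G, hG⟩ := hex (f := f.symm) ⟨hf.2, hf.1⟩
  have hk0 : 0 < k := by omega
  refine ⟨⟨F, G, fun p => ?_, fun p => ?_⟩, hF⟩
  · obtain ⟨b, i, -, hb, -⟩ := exists_basis_proj (ι := ι) h2 (hι.trans hV.symm) p.2 p.2 rfl
    obtain ⟨b', hb'⟩ := exists_isImage h2 hι hk hV hf b
    have hp : p = ⟨proj b i, proj_mem_lineProjections b i⟩ := Subtype.ext hb
    rw [hp, hF b b' hb', hG b' b (hb'.symm h2 hι hk0)]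
  · obtain ⟨b, i, -, hb, -⟩ := exists_basis_proj (ι := ι) h2 (hι.trans hV.symm) p.2 p.2 rfl
    obtain ⟨b', hb'⟩ := exists_isImage h2 hι hk hV (f := f.symm) ⟨hf.2, hf.1⟩ b
    have hp : p = ⟨proj b i, proj_mem_lineProjections b i⟩ := Subtype.ext hb
    rw [hp, hG b b' hb', hF b' b]
    simpa using hb'.symm h2 hι hk0

end Moves

/-! ### Sets with two equivalence relations -/

section Types

variable {α β : Type*} {E₁ E₂ : α → α → Prop} {E₁' E₂' : β → β → Prop}

/-- If the type of one pair of distinct points is preserved, then so are the types of all pairs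
with the same first point: two neighbours of a point are related precisely if they are its
neighbours for the same relation. -/
theorem preserves_of_adjacent (h₁ : Equivalence E₁) (h₂ : Equivalence E₂)
    (h₁' : Equivalence E₁') (h₂' : Equivalence E₂')
    (heq : ∀ p q, E₁ p q → E₂ p q → p = q) (heq' : ∀ p q, E₁' p q → E₂' p q → p = q)
    (F : α ≃ β) (hF : ∀ p q, (E₁ p q ∨ E₂ p q) ↔ (E₁' (F p) (F q) ∨ E₂' (F p) (F q)))
    {p q : α} (hne : p ≠ q) (hpq : E₁ p q) (hpq' : E₁' (F p) (F q)) :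
    (∀ r, E₁ p r → E₁' (F p) (F r)) ∧ (∀ r, E₂ p r → E₂' (F p) (F r)) := by
  constructor
  · intro r hr
    rcases (hF p r).1 (Or.inl hr) with h | h
    · exact h
    rcases (hF q r).1 (Or.inl (h₁.trans (h₁.symm hpq) hr)) with h' | h'
    · exact h₁'.trans hpq' h'
    · exact absurd (F.injective (heq' _ _ hpq' (h₂'.trans h (h₂'.symm h')))) hne
  · intro r hr
    rcases (hF p r).1 (Or.inr hr) with h | h
    · rcases (hF q r).2 (Or.inl (h₁'.trans (h₁'.symm hpq') h)) with h' | h'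
      · rw [heq p r (h₁.trans hpq h') hr]
        exact h₂'.refl _
      · exact absurd (heq p q hpq (h₂.trans hr (h₂.symm h'))) hne
    · exact h

/-- Let each of two sets carry two equivalence relations that intersect in equality, such that
on the first set all classes are nontrivial and any two points are joined by a path.
A bijection that preserves the union of the two relations
preserves both relations or interchanges them. -/
theorem preserves_or_swaps (h₁ : Equivalence E₁) (h₂ : Equivalence E₂)
    (h₁' : Equivalence E₁') (h₂' : Equivalence E₂')
    (heq : ∀ p q, E₁ p q → E₂ p q → p = q) (heq' : ∀ p q, E₁' p q → E₂' p q → p = q)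
    (hconn : ∀ p q, ∃ r s, E₁ p r ∧ E₂ r s ∧ E₁ s q)
    (hnt₁ : ∀ p, ∃ q, p ≠ q ∧ E₁ p q)
    (F : α ≃ β) (hF : ∀ p q, (E₁ p q ∨ E₂ p q) ↔ (E₁' (F p) (F q) ∨ E₂' (F p) (F q))) :
    ((∀ p q, E₁ p q ↔ E₁' (F p) (F q)) ∧ (∀ p q, E₂ p q ↔ E₂' (F p) (F q))) ∨
    ((∀ p q, E₁ p q ↔ E₂' (F p) (F q)) ∧ (∀ p q, E₂ p q ↔ E₁' (F p) (F q))) := by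
  -- The statement is symmetric under exchanging the two relations of the target.
  have key : ∀ {E₁' E₂' : β → β → Prop}, Equivalence E₁' → Equivalence E₂' →
      (∀ p q, E₁' p q → E₂' p q → p = q) →
      (∀ p q, (E₁ p q ∨ E₂ p q) ↔ (E₁' (F p) (F q) ∨ E₂' (F p) (F q))) →
      (∃ p q, p ≠ q ∧ E₁ p q ∧ E₁' (F p) (F q)) →
      ((∀ p q, E₁ p q ↔ E₁' (F p) (F q)) ∧ (∀ p q, E₂ p q ↔ E₂' (F p) (F q))) := by
    clear hF heq' h₁' h₂'
    intro E₁' E₂' h₁' h₂' heq' hF ⟨p₀, q₀, hne, hE, hE'⟩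
    let good : α → Prop := fun p =>
      (∀ r, E₁ p r → E₁' (F p) (F r)) ∧ (∀ r, E₂ p r → E₂' (F p) (F r))
    have hgood₁ : ∀ p q, good p → E₁ p q → good q := by
      intro p q hp hpq
      by_cases hne : q = p
      · rwa [hne]
      · exact preserves_of_adjacent h₁ h₂ h₁' h₂' heq heq' F hF hne (h₁.symm hpq)
          (h₁'.symm (hp.1 q hpq))
    have hgood₂ : ∀ p q, good p → E₂ p q → good q := by
      intro p q hp hpq
      by_cases hne : q = p
      · rwa [hne]
      · exact (preserves_of_adjacent h₂ h₁ h₂' h₁' (fun p q h h' => heq p q h' h)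
          (fun p q h h' => heq' p q h' h) F (fun p q => by rw [or_comm, hF, or_comm]) hne
          (h₂.symm hpq) (h₂'.symm (hp.2 q hpq))).symm
    have hall : ∀ q, good q := by
      intro q
      obtain ⟨r, s, hr, hs, hq⟩ := hconn p₀ q
      exact hgood₁ _ _ (hgood₂ _ _ (hgood₁ _ _
        (preserves_of_adjacent h₁ h₂ h₁' h₂' heq heq' F hF hne hE hE') hr) hs) hq
    refine ⟨fun p q => ⟨(hall p).1 q, fun h => ?_⟩, fun p q => ⟨(hall p).2 q, fun h => ?_⟩⟩
    · rcases (hF p q).2 (Or.inl h) with h' | h'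
      · exact h'
      · rw [F.injective (heq' _ _ h ((hall p).2 q h'))]
        exact h₁.refl _
    · rcases (hF p q).2 (Or.inr h) with h' | h'
      · rw [F.injective (heq' _ _ ((hall p).1 q h') h)]
        exact h₂.refl _
      · exact h'
  by_cases hα : Nonempty α
  · obtain ⟨p⟩ := hα
    obtain ⟨q, hne, hpq⟩ := hnt₁ p
    rcases (hF p q).1 (Or.inl hpq) with h | h
    · exact Or.inl (key h₁' h₂' heq' hF ⟨p, q, hne, hpq, h⟩)
    · exact Or.inr (key h₂' h₁' (fun p q h h' => heq' p q h' h)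
        (fun p q => by rw [hF, or_comm]) ⟨p, q, hne, hpq, h⟩)
  · exact Or.inl ⟨fun p => (hα ⟨p⟩).elim, fun p => (hα ⟨p⟩).elim⟩

end Types

/-! ### Orthogonality of line projections -/

section Projections

open Module

variable {R : Type*} [DivisionRing R] {V : Type*} [AddCommGroup V] [Module R V]

/-- A vector spanning the range of a line projection. -/
noncomputable def vec (p : lineProjections R V) : V := p.2.choose

/-- The linear form defining a line projection, normalized to be `1` at `vec p`. -/
noncomputable def form (p : lineProjections R V) : V →ₗ[R] R := p.2.choose_spec.choose

theorem form_vec (p : lineProjections R V) : form p (vec p) = 1 :=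
  p.2.choose_spec.choose_spec.1

theorem coe_apply (p : lineProjections R V) (v : V) : p.1 v = form p v • vec p :=
  LinearMap.congr_fun p.2.choose_spec.choose_spec.2 v

theorem vec_ne_zero (p : lineProjections R V) : vec p ≠ 0 := by
  intro h
  have := form_vec p
  simp [h] at this

/-- The projection onto the line of `x` with kernel that of `φ`. -/
def lineProj (x : V) (φ : V →ₗ[R] R) (h : φ x ≠ 0) : lineProjections R V :=
  ⟨LinearMap.toSpanSingleton R V ((φ x)⁻¹ • x) ∘ₗ φ, (φ x)⁻¹ • x, φ, by simp [h], rfl⟩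

theorem lineProj_apply (x : V) (φ : V →ₗ[R] R) (h : φ x ≠ 0) (v : V) :
    (lineProj x φ h).1 v = (φ v * (φ x)⁻¹) • x := by
  simp [lineProj, smul_smul]

theorem coe_apply_eq_zero {p : lineProjections R V} {v : V} : p.1 v = 0 ↔ form p v = 0 := by
  rw [coe_apply, smul_eq_zero]
  simp [vec_ne_zero]

theorem coe_apply_vec (p : lineProjections R V) : p.1 (vec p) = vec p := by
  rw [coe_apply, form_vec, one_smul]

theorem form_lineProj_eq_zero {x : V} {φ : V →ₗ[R] R} (h : φ x ≠ 0) {v : V} :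
    form (lineProj x φ h) v = 0 ↔ φ v = 0 := by
  rw [← coe_apply_eq_zero, lineProj_apply, smul_eq_zero]
  have hx : x ≠ 0 := by rintro rfl; simp at h
  simp [hx, h]

theorem exists_vec_lineProj {x : V} {φ : V →ₗ[R] R} (h : φ x ≠ 0) :
    ∃ c : R, c ≠ 0 ∧ vec (lineProj x φ h) = c • x := by
  have e := coe_apply_vec (lineProj x φ h)
  rw [lineProj_apply] at e
  refine ⟨_, ?_, e.symm⟩
  intro h0
  rw [h0, zero_smul] at e
  exact vec_ne_zero _ e.symm

/-- Two line projections are orthogonal if their products in both orders vanish. -/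
def Orth (p q : lineProjections R V) : Prop := p.1 * q.1 = 0 ∧ q.1 * p.1 = 0

/-- Two line projections have the same range. -/
def SameRange (p q : lineProjections R V) : Prop := p.1 * q.1 = q.1 ∧ q.1 * p.1 = p.1

/-- Two line projections have the same kernel. -/
def SameKer (p q : lineProjections R V) : Prop := p.1 * q.1 = p.1 ∧ q.1 * p.1 = q.1

theorem coe_mul_coe_eq_zero_iff {p q : lineProjections R V} :
    p.1 * q.1 = 0 ↔ form p (vec q) = 0 := by
  constructor
  · intro h
    have := LinearMap.congr_fun h (vec q)
    rw [Module.End.mul_apply, coe_apply_vec, LinearMap.zero_apply] at this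
    exact coe_apply_eq_zero.1 this
  · intro h
    ext v
    rw [Module.End.mul_apply, coe_apply q, map_smul, coe_apply_eq_zero.2 h, smul_zero,
      LinearMap.zero_apply]

theorem orth_iff {p q : lineProjections R V} :
    Orth p q ↔ form p (vec q) = 0 ∧ form q (vec p) = 0 :=
  and_congr coe_mul_coe_eq_zero_iff coe_mul_coe_eq_zero_iff

theorem Orth.symm {p q : lineProjections R V} (h : Orth p q) : Orth q p := ⟨h.2, h.1⟩

theorem coe_apply_eq_self {p : lineProjections R V} {x : V}
    (h : x ∈ Submodule.span R {vec p}) : p.1 x = x := by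
  obtain ⟨c, rfl⟩ := Submodule.mem_span_singleton.1 h
  rw [map_smul, coe_apply_vec]

theorem mem_span_of_mem_span {x y : V} (hx : x ≠ 0) (h : x ∈ Submodule.span R {y}) :
    y ∈ Submodule.span R {x} := by
  obtain ⟨c, rfl⟩ := Submodule.mem_span_singleton.1 h
  have hc : c ≠ 0 := by rintro rfl; simp at hx
  exact Submodule.mem_span_singleton.2 ⟨c⁻¹, by rw [smul_smul, inv_mul_cancel₀ hc, one_smul]⟩

theorem sameRange_iff {p q : lineProjections R V} :
    SameRange p q ↔ vec q ∈ Submodule.span R {vec p} := by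
  have key : ∀ p q : lineProjections R V, vec q ∈ Submodule.span R {vec p} →
      p.1 * q.1 = q.1 := by
    intro p q h
    ext v
    rw [Module.End.mul_apply]
    apply coe_apply_eq_self
    rw [coe_apply]
    exact Submodule.smul_mem _ _ h
  constructor
  · intro h
    have := LinearMap.congr_fun h.1 (vec q)
    rw [Module.End.mul_apply, coe_apply_vec, coe_apply] at this
    exact Submodule.mem_span_singleton.2 ⟨_, this⟩
  · intro h
    exact ⟨key p q h, key q p (mem_span_of_mem_span (vec_ne_zero q) h)⟩

theorem coe_apply_sub (p : lineProjections R V) (v : V) : p.1 (v - p.1 v) = 0 := by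
  rw [map_sub, ← Module.End.mul_apply, lineProjections_mul_self p.2, sub_self]

/-- An inclusion between kernels of line projections is an equality. -/
theorem form_eq_zero_of_ker_le {p q : lineProjections R V}
    (h : ∀ v, form p v = 0 → form q v = 0) (v : V) (hv : form q v = 0) : form p v = 0 := by
  have h1 : form q (v - p.1 v) = 0 := h _ (coe_apply_eq_zero.1 (coe_apply_sub p v))
  rw [map_sub, hv, zero_sub, neg_eq_zero, coe_apply, map_smul, smul_eq_mul, mul_eq_zero] at h1
  refine h1.resolve_right fun h0 => ?_
  have h3 : form q (vec q - p.1 (vec q)) = 0 := h _ (coe_apply_eq_zero.1 (coe_apply_sub p _))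
  rw [map_sub, form_vec, coe_apply, map_smul, h0, smul_zero, sub_zero] at h3
  exact one_ne_zero h3

theorem sameKer_iff {p q : lineProjections R V} :
    SameKer p q ↔ ∀ v, form p v = 0 → form q v = 0 := by
  have key : ∀ p q : lineProjections R V, (∀ v, form p v = 0 → form q v = 0) →
      q.1 * p.1 = q.1 := by
    intro p q h
    ext v
    have := coe_apply_eq_zero.2 (h _ (coe_apply_eq_zero.1 (coe_apply_sub p v)))
    rw [map_sub, sub_eq_zero] at this
    exact this.symm
  constructor
  · intro h v hv
    rw [← coe_apply_eq_zero, ← h.2, Module.End.mul_apply, coe_apply_eq_zero.2 hv, map_zero]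
  · intro h
    exact ⟨key q p (form_eq_zero_of_ker_le h), key p q h⟩

theorem sameRange_equivalence : Equivalence (SameRange (R := R) (V := V)) where
  refl p := ⟨lineProjections_mul_self p.2, lineProjections_mul_self p.2⟩
  symm h := ⟨h.2, h.1⟩
  trans {p q r} h h' := by
    rw [SameRange] at *
    constructor
    · rw [← h'.1, ← mul_assoc, h.1]
    · rw [← h.2, ← mul_assoc, h'.2]

theorem sameKer_equivalence : Equivalence (SameKer (R := R) (V := V)) where
  refl p := ⟨lineProjections_mul_self p.2, lineProjections_mul_self p.2⟩
  symm h := ⟨h.2, h.1⟩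
  trans {p q r} h h' := by
    rw [SameKer] at *
    constructor
    · rw [← h.1, mul_assoc, h'.1]
    · rw [← h'.2, mul_assoc, h.2]

theorem eq_of_sameRange_of_sameKer {p q : lineProjections R V} (h : SameRange p q)
    (h' : SameKer p q) : p = q :=
  Subtype.ext (h'.1.symm.trans h.1)

/-- The line projections orthogonal to everything that is orthogonal to both `p` and `q`. -/
def biorth (p q : lineProjections R V) : Set (lineProjections R V) :=
  {s | ∀ r, Orth p r → Orth q r → Orth s r}

theorem biorth_comm (p q : lineProjections R V) : biorth p q = biorth q p :=
  Set.ext fun _ => ⟨fun h r hq hp => h r hp hq, fun h r hp hq => h r hq hp⟩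

theorem finrank_span_pair_le (x y : V) : finrank R (Submodule.span R {x, y}) ≤ 2 := by
  classical
  have := finrank_span_finset_le_card (R := R) ({x, y} : Finset V)
  rw [Finset.coe_pair] at this
  exact this.trans Finset.card_le_two

theorem finrank_span_triple_le (x y z : V) : finrank R (Submodule.span R {x, y, z}) ≤ 3 := by
  classical
  have := finrank_span_finset_le_card (R := R) ({x, y, z} : Finset V)
  rw [Finset.coe_insert, Finset.coe_pair] at this
  exact this.trans Finset.card_le_three

theorem exists_sameRange_sameKer_sameRange (p q : lineProjections R V) :
    ∃ r s, SameRange p r ∧ SameKer r s ∧ SameRange s q := by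
  obtain ⟨φ, hp, hq⟩ : ∃ φ : V →ₗ[R] R, φ (vec p) ≠ 0 ∧ φ (vec q) ≠ 0 := by
    by_cases h1 : form p (vec q) = 0
    · by_cases h3 : form q (vec p) = 0
      · exact ⟨form p + form q, by simp [h3, form_vec], by simp [h1, form_vec]⟩
      · exact ⟨form q, h3, by simp [form_vec]⟩
    · exact ⟨form p, by simp [form_vec], h1⟩
  obtain ⟨c, hc, hvec⟩ := exists_vec_lineProj hp
  obtain ⟨d, hd, hvec'⟩ := exists_vec_lineProj hq
  refine ⟨lineProj (vec p) φ hp, lineProj (vec q) φ hq, ?_, ?_, ?_⟩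
  · rw [sameRange_iff, hvec]
    exact Submodule.smul_mem _ _ (Submodule.mem_span_singleton_self _)
  · rw [sameKer_iff]
    intro v
    rw [form_lineProj_eq_zero, form_lineProj_eq_zero]
    exact id
  · apply sameRange_equivalence.symm
    rw [sameRange_iff, hvec']
    exact Submodule.smul_mem _ _ (Submodule.mem_span_singleton_self _)

variable [FiniteDimensional R V]

theorem finrank_ker_inf_ker (φ ψ : V →ₗ[R] R) :
    finrank R V ≤ finrank R (LinearMap.ker φ ⊓ LinearMap.ker ψ : Submodule R V) + 2 := by
  have h := (φ.prod ψ).finrank_range_add_finrank_ker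
  rw [LinearMap.ker_prod] at h
  have h' := Submodule.finrank_le (LinearMap.range (φ.prod ψ))
  rw [Module.finrank_prod, Module.finrank_self] at h'
  omega

theorem exists_mem_notMem_of_finrank_lt {U W : Submodule R V}
    (h : finrank R W < finrank R U) : ∃ y ∈ U, y ∉ W := by
  by_contra! hcon
  exact absurd (Submodule.finrank_mono (show U ≤ W from hcon)) (by omega)

/-- The biorthogonal of `p` and `q` consists of the line projections whose range lies in the sum of
the ranges, and whose kernel contains the intersection of the kernels. -/
theorem mem_biorth_iff (hV : 6 ≤ finrank R V) {p q s : lineProjections R V} :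
    s ∈ biorth p q ↔ vec s ∈ Submodule.span R {vec p, vec q} ∧
      ∀ v, form p v = 0 → form q v = 0 → form s v = 0 := by
  have hC := finrank_ker_inf_ker (form p) (form q)
  constructor
  · intro hs
    have key : ∀ (y : V) (ψ : V →ₗ[R] R), form p y = 0 → form q y = 0 → ψ (vec p) = 0 →
        ψ (vec q) = 0 → ψ y ≠ 0 → form s y = 0 ∧ ψ (vec s) = 0 := by
      intro y ψ hpy hqy hψp hψq hψy
      obtain ⟨c, hc, hvec⟩ := exists_vec_lineProj hψy
      have h := hs (lineProj y ψ hψy)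
        (orth_iff.2 ⟨by rw [hvec, map_smul, hpy, smul_zero], (form_lineProj_eq_zero _).2 hψp⟩)
        (orth_iff.2 ⟨by rw [hvec, map_smul, hqy, smul_zero], (form_lineProj_eq_zero _).2 hψq⟩)
      rw [orth_iff, form_lineProj_eq_zero, hvec, map_smul, smul_eq_zero] at h
      exact ⟨h.1.resolve_left hc, h.2⟩
    constructor
    · by_contra hx
      obtain ⟨y, hy, hyW⟩ := exists_mem_notMem_of_finrank_lt
        (U := LinearMap.ker (form p) ⊓ LinearMap.ker (form q))
        (W := Submodule.span R {vec s, vec p, vec q})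
        (lt_of_le_of_lt (finrank_span_triple_le _ _ _) (by omega))
      -- A linear form vanishing on the following span takes the same value at `vec s` and `y`.
      have hxW : vec s ∉ Submodule.span R {vec s - y, vec p, vec q} := by
        intro h
        obtain ⟨c, w, hw, he⟩ := Submodule.mem_span_insert.1 h
        by_cases hc : c = 0
        · rw [he, hc, zero_smul, zero_add] at hx
          exact hx hw
        · apply hyW
          have e : y = c⁻¹ • (c • vec s + w - vec s) := by
            have : c • vec s + w - vec s = c • y := by
              nth_rewrite 2 [he]
              rw [smul_sub]; abel
            rw [this, smul_smul, inv_mul_cancel₀ hc, one_smul]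
          have hs' : vec s ∈ Submodule.span R {vec s, vec p, vec q} :=
            Submodule.subset_span (by simp)
          have hw' : w ∈ Submodule.span R {vec s, vec p, vec q} :=
            Submodule.span_mono (Set.subset_insert _ _) hw
          rw [e]
          exact Submodule.smul_mem _ _ (Submodule.sub_mem _
            (Submodule.add_mem _ (Submodule.smul_mem _ _ hs') hw') hs')
      obtain ⟨ψ, hψ, hle⟩ := Submodule.exists_le_ker_of_notMem hxW
      have hmem : ∀ z ∈ ({vec s - y, vec p, vec q} : Set V), ψ z = 0 := fun z hz =>
        hle (Submodule.subset_span hz)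
      have h0 := hmem (vec s - y) (by simp)
      rw [map_sub, sub_eq_zero] at h0
      exact hψ (key y ψ hy.1 hy.2 (hmem _ (by simp)) (hmem _ (by simp)) (h0 ▸ hψ)).2
    · intro z hpz hqz
      by_contra hz
      obtain ⟨y, hpy, hqy, hsy, hyW⟩ : ∃ y, form p y = 0 ∧ form q y = 0 ∧ form s y ≠ 0 ∧
          y ∉ Submodule.span R {vec p, vec q} := by
        -- If `z` is in the span, correct it by a vector common to all three kernels.
        by_cases hzW : z ∈ Submodule.span R {vec p, vec q}
        · obtain ⟨c, hc, hcW⟩ := exists_mem_notMem_of_finrank_lt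
            (U := (LinearMap.ker (form p) ⊓ LinearMap.ker (form q)) ⊓ LinearMap.ker (form s))
            (W := Submodule.span R {vec p, vec q}) (by
              have h1 := finrank_span_pair_le (R := R) (vec p) (vec q)
              have h2 := Submodule.finrank_sup_add_finrank_inf_eq
                (LinearMap.ker (form p) ⊓ LinearMap.ker (form q)) (LinearMap.ker (form s))
              have h3 := Submodule.finrank_le
                ((LinearMap.ker (form p) ⊓ LinearMap.ker (form q)) ⊔ LinearMap.ker (form s))
              have h4 := (form s).finrank_range_add_finrank_ker
              have h5 := Submodule.finrank_le (LinearMap.range (form s))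
              rw [Module.finrank_self] at h5
              omega)
          refine ⟨z + c, ?_, ?_, ?_, ?_⟩
          · rw [map_add, hpz, zero_add]; exact hc.1.1
          · rw [map_add, hqz, zero_add]; exact hc.1.2
          · rw [map_add, show form s c = 0 from hc.2, add_zero]; exact hz
          · intro h
            exact hcW ((Submodule.add_mem_iff_right _ hzW).1 h)
        · exact ⟨z, hpz, hqz, hz, hzW⟩
      obtain ⟨ψ, hψ, hle⟩ := Submodule.exists_le_ker_of_notMem hyW
      have hmem : ∀ z ∈ ({vec p, vec q} : Set V), ψ z = 0 := fun z hz =>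
        hle (Submodule.subset_span hz)
      exact hsy (key y ψ hpy hqy (hmem _ (by simp)) (hmem _ (by simp)) hψ).1
  · rintro ⟨hx, hφ⟩ r hp hq
    rw [orth_iff] at *
    refine ⟨hφ _ hp.1 hq.1, ?_⟩
    obtain ⟨a, c, h⟩ := Submodule.mem_span_pair.1 hx
    rw [← h, map_add, map_smul, map_smul, hp.2, hq.2]
    simp

theorem mem_biorth_of_sameRange (hV : 6 ≤ finrank R V) {p q s s' : lineProjections R V}
    (h : SameRange p q) (hs : s ∈ biorth p q) (hs' : s' ∈ biorth p q) (hne : s ≠ s') :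
    p ∈ biorth s s' := by
  rw [mem_biorth_iff hV] at *
  rw [sameRange_iff] at h
  have hspan : Submodule.span R {vec p, vec q} ≤ Submodule.span R {vec p} := by
    rw [Submodule.span_le]
    rintro _ (rfl | rfl)
    · exact Submodule.mem_span_singleton_self _
    · exact h
  have hsp := mem_span_of_mem_span (vec_ne_zero s) (hspan hs.1)
  refine ⟨Submodule.span_mono (by simp) hsp, ?_⟩
  let C := LinearMap.ker (form p) ⊓ LinearMap.ker (form q)
  let K := LinearMap.ker (form s) ⊓ LinearMap.ker (form s')
  have hCK : C ≤ K := fun v hv => ⟨hs.2 v hv.1 hv.2, hs'.2 v hv.1 hv.2⟩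
  have hlt : K < LinearMap.ker (form s) := by
    refine lt_of_le_of_ne inf_le_left fun he => hne ?_
    refine eq_of_sameRange_of_sameKer (sameRange_iff.2 ?_) (sameKer_iff.2 fun v hv => ?_)
    · obtain ⟨c, hc⟩ := Submodule.mem_span_singleton.1 hsp
      have := hspan hs'.1
      rw [← hc] at this
      exact Submodule.span_singleton_smul_le R c _ this
    · have hv' : v ∈ K := by rw [he]; exact hv
      exact hv'.2
  have hlt' : LinearMap.ker (form s) < ⊤ := by
    rw [lt_top_iff_ne_top]
    intro he
    have : vec s ∈ LinearMap.ker (form s) := by rw [he]; trivial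
    rw [LinearMap.mem_ker, form_vec] at this
    exact one_ne_zero this
  have h1 := Submodule.finrank_lt_finrank_of_lt hlt
  have h2 := Submodule.finrank_lt hlt'.ne
  have hC := finrank_ker_inf_ker (form p) (form q)
  have : C = K := Submodule.eq_of_le_of_finrank_le hCK (by
    change finrank R V ≤ finrank R C + 2 at hC
    omega)
  intro v hv hv'
  have hvK : v ∈ K := ⟨hv, hv'⟩
  rw [← this] at hvK
  exact hvK.1

theorem mem_biorth_of_sameKer (hV : 6 ≤ finrank R V) {p q s s' : lineProjections R V}
    (h : SameKer p q) (hs : s ∈ biorth p q) (hs' : s' ∈ biorth p q) (hne : s ≠ s') :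
    p ∈ biorth s s' := by
  rw [mem_biorth_iff hV] at *
  have hps : SameKer p s := by
    rw [sameKer_iff] at h ⊢
    exact fun v hv => hs.2 v hv (h v hv)
  have hps' : SameKer p s' := by
    rw [sameKer_iff] at h ⊢
    exact fun v hv => hs'.2 v hv (h v hv)
  refine ⟨?_, fun v hv _ => sameKer_iff.1 (sameKer_equivalence.symm hps) v hv⟩
  have hle : Submodule.span R {vec s, vec s'} ≤ Submodule.span R {vec p, vec q} := by
    rw [Submodule.span_le]
    rintro _ (rfl | rfl)
    exacts [hs.1, hs'.1]
  have hlt : Submodule.span R {vec s} < Submodule.span R {vec s, vec s'} := by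
    refine lt_of_le_of_ne (Submodule.span_mono (by simp)) fun he => hne ?_
    refine eq_of_sameRange_of_sameKer (sameRange_iff.2 ?_)
      (sameKer_equivalence.trans (sameKer_equivalence.symm hps) hps')
    rw [he]
    exact Submodule.subset_span (by simp)
  have h1 := Submodule.finrank_lt_finrank_of_lt hlt
  rw [finrank_span_singleton (vec_ne_zero s)] at h1
  rw [Submodule.eq_of_le_of_finrank_le hle ((finrank_span_pair_le _ _).trans h1)]
  exact Submodule.subset_span (by simp)

/-- Having the same range or the same kernel is expressible by orthogonality: it means that the
biorthogonal of a pair is generated by any two of its members. -/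
theorem sameRange_or_sameKer_iff (h2 : (2 : R) ≠ 0) (hV : 6 ≤ finrank R V)
    {p q : lineProjections R V} :
    SameRange p q ∨ SameKer p q ↔ ∀ s ∈ biorth p q, ∀ s' ∈ biorth p q, s ≠ s' →
      p ∈ biorth s s' ∧ q ∈ biorth s s' := by
  constructor
  · rintro (h | h) s hs s' hs' hne
    · exact ⟨mem_biorth_of_sameRange hV h hs hs' hne, mem_biorth_of_sameRange hV
        (sameRange_equivalence.symm h) (biorth_comm p q ▸ hs) (biorth_comm p q ▸ hs') hne⟩
    · exact ⟨mem_biorth_of_sameKer hV h hs hs' hne, mem_biorth_of_sameKer hV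
        (sameKer_equivalence.symm h) (biorth_comm p q ▸ hs) (biorth_comm p q ▸ hs') hne⟩
  · intro h
    by_contra! hcon
    obtain ⟨hr, hk⟩ := hcon
    -- Modify the linear form of `p` by that of `q`, with a sign that keeps it nonzero on `vec p`.
    obtain ⟨φ, hφ, hφker, hφ0⟩ : ∃ φ : V →ₗ[R] R, φ (vec p) ≠ 0 ∧
        (∀ v, form p v = 0 → φ v = 0 → form q v = 0) ∧
        (∀ v, form p v = 0 → form q v = 0 → φ v = 0) := by
      by_cases h0 : (form p + form q) (vec p) = 0
      · refine ⟨form p - form q, ?_, fun v h1 h3 => ?_, fun v h1 h3 => ?_⟩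
        · rw [LinearMap.add_apply, form_vec, add_comm, add_eq_zero_iff_eq_neg] at h0
          rw [LinearMap.sub_apply, form_vec, h0]
          norm_num
          exact h2
        · simpa [h1] using h3
        · simp [h1, h3]
      · refine ⟨form p + form q, h0, fun v h1 h3 => ?_, fun v h1 h3 => ?_⟩
        · simpa [h1] using h3
        · simp [h1, h3]
    obtain ⟨c, hc, hvec⟩ := exists_vec_lineProj hφ
    have hp : p ∈ biorth p q := fun r h _ => h
    have hs' : lineProj (vec p) φ hφ ∈ biorth p q := by
      rw [mem_biorth_iff hV, hvec]
      refine ⟨Submodule.smul_mem _ _ (Submodule.subset_span (by simp)), fun v h1 h3 => ?_⟩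
      rw [form_lineProj_eq_zero]
      exact hφ0 v h1 h3
    have hne : p ≠ lineProj (vec p) φ hφ := by
      intro he
      refine hk (sameKer_iff.2 fun v hv => hφker v hv ?_)
      rw [← form_lineProj_eq_zero hφ, ← he]
      exact hv
    have := ((mem_biorth_iff hV).1 (h p hp _ hs' hne).2).1
    rw [hvec] at this
    refine hr (sameRange_iff.2 (Submodule.span_le.2 ?_ this))
    rintro _ (rfl | rfl)
    · exact Submodule.mem_span_singleton_self _
    · exact Submodule.smul_mem _ _ (Submodule.mem_span_singleton_self _)

theorem exists_ne_sameRange (hV : 2 ≤ finrank R V) (p : lineProjections R V) :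
    ∃ q, p ≠ q ∧ SameRange p q := by
  obtain ⟨y, -, hy⟩ := exists_mem_notMem_of_finrank_lt (R := R) (U := (⊤ : Submodule R V))
    (W := Submodule.span R {vec p}) (by rw [finrank_span_singleton (vec_ne_zero p), finrank_top]
                                        omega)
  obtain ⟨χ, hχ, hle⟩ := Submodule.exists_le_ker_of_notMem hy
  have hχp : χ (vec p) = 0 := hle (Submodule.mem_span_singleton_self _)
  have h1 : (form p + χ) (vec p) = 1 := by simp [hχp, form_vec]
  obtain ⟨c, hc, hvec⟩ := exists_vec_lineProj (φ := form p + χ) (h1 ▸ one_ne_zero)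
  refine ⟨lineProj (vec p) (form p + χ) (h1 ▸ one_ne_zero), fun he => ?_, ?_⟩
  · have := congrArg (fun r : lineProjections R V => r.1 y) he
    simp only [lineProj_apply, h1, inv_one, mul_one] at this
    rw [coe_apply, LinearMap.add_apply, add_smul, left_eq_add, smul_eq_zero] at this
    exact this.elim hχ (vec_ne_zero p)
  · rw [sameRange_iff, hvec]
    exact Submodule.smul_mem _ _ (Submodule.mem_span_singleton_self _)

/-- A bijection of the line projections that preserves orthogonality in both directions preserves
equality of ranges and equality of kernels, or it interchanges these two relations. -/
theorem preserves_or_swaps_of_orth (h2 : (2 : R) ≠ 0) (hV : 6 ≤ finrank R V)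
    (F : lineProjections R V ≃ lineProjections R V) (hF : ∀ p q, Orth p q ↔ Orth (F p) (F q)) :
    ((∀ p q, SameRange p q ↔ SameRange (F p) (F q)) ∧
      (∀ p q, SameKer p q ↔ SameKer (F p) (F q))) ∨
    ((∀ p q, SameRange p q ↔ SameKer (F p) (F q)) ∧
      (∀ p q, SameKer p q ↔ SameRange (F p) (F q))) := by
  refine preserves_or_swaps sameRange_equivalence sameKer_equivalence sameRange_equivalence
    sameKer_equivalence (fun _ _ => eq_of_sameRange_of_sameKer)
    (fun _ _ => eq_of_sameRange_of_sameKer) exists_sameRange_sameKer_sameRange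
    (exists_ne_sameRange (by omega)) F fun p q => ?_
  have hb : ∀ s p q, s ∈ biorth p q ↔ F s ∈ biorth (F p) (F q) := by
    intro s p q
    constructor
    · intro h r hp hq
      have := h (F.symm r)
      rw [hF, hF q, hF s, Equiv.apply_symm_apply] at this
      exact this hp hq
    · intro h r hp hq
      exact (hF _ _).2 (h (F r) ((hF _ _).1 hp) ((hF _ _).1 hq))
  rw [sameRange_or_sameKer_iff h2 hV, sameRange_or_sameKer_iff h2 hV]
  constructor
  · intro h s hs s' hs' hne
    have := h (F.symm s) ((hb _ _ _).2 (by simpa using hs)) (F.symm s')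
      ((hb _ _ _).2 (by simpa using hs')) (by simpa using hne)
    rw [hb, hb q] at this
    simpa using this
  · intro h s hs s' hs' hne
    rw [hb, hb q]
    exact h (F s) ((hb _ _ _).1 hs) (F s') ((hb _ _ _).1 hs') (by simpa using hne)

end Projections

/-! ### The fundamental theorem of projective geometry -/

section Projective

open Module Submodule

theorem indep_triple {R V : Type*} [DivisionRing R] [AddCommGroup V] [Module R V] {a x y : V}
    (ha : a ≠ 0) (hx : x ∉ span R {a}) (hy : y ∉ span R {a, x}) {A B C : R}
    (h : A • a + B • x + C • y = 0) : A = 0 ∧ B = 0 ∧ C = 0 := by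
  have hC : C = 0 := by
    by_contra hC
    apply hy
    have : y = (-(C⁻¹ * A)) • a + (-(C⁻¹ * B)) • x := by
      have h' : C • y = -(A • a + B • x) := by
        rw [eq_neg_iff_add_eq_zero, add_comm]; exact h
      have : y = C⁻¹ • (C • y) := by rw [smul_smul, inv_mul_cancel₀ hC, one_smul]
      rw [this, h']
      simp only [smul_neg, smul_add, smul_smul, neg_smul, neg_add]
    rw [this]
    exact mem_span_pair.2 ⟨_, _, rfl⟩
  rw [hC, zero_smul, add_zero] at h
  have hB : B = 0 := by
    by_contra hB
    apply hx
    have h' : B • x = -(A • a) := by rw [eq_neg_iff_add_eq_zero, add_comm]; exact h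
    have : x = (-(B⁻¹ * A)) • a := by
      have : x = B⁻¹ • (B • x) := by rw [smul_smul, inv_mul_cancel₀ hB, one_smul]
      rw [this, h', smul_neg, smul_smul, neg_smul]
    rw [this]
    exact smul_mem _ _ (mem_span_singleton_self _)
  rw [hB, zero_smul, add_zero, smul_eq_zero] at h
  exact ⟨h.resolve_right ha, hB, hC⟩

variable {R R' V V' : Type*} [DivisionRing R] [DivisionRing R'] [AddCommGroup V] [Module R V]
  [AddCommGroup V'] [Module R' V']

/-- A map of vectors inducing an isomorphism of the projective spaces: it sends nonzero vectors to
nonzero vectors, preserves and reflects collinearity of the lines they span, and reaches every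
line. Its value at `0` is irrelevant. -/
structure IsCollineation (R R' : Type*) {V V' : Type*} [DivisionRing R] [DivisionRing R']
    [AddCommGroup V] [Module R V] [AddCommGroup V'] [Module R' V'] (g : V → V') : Prop where
  ne_zero : ∀ x, x ≠ 0 → g x ≠ 0
  mem_span_iff : ∀ x y z, x ≠ 0 → y ≠ 0 → z ≠ 0 →
    (z ∈ span R {x, y} ↔ g z ∈ span R' {g x, g y})
  surjective : ∀ y, y ≠ 0 → ∃ x, x ≠ 0 ∧ y ∈ span R' {g x}

namespace IsCollineation

variable {g : V → V'} (hg : IsCollineation R R' g)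

include hg

theorem mem_span_singleton_iff {x y : V} (hx : x ≠ 0) (hy : y ≠ 0) :
    y ∈ span R {x} ↔ g y ∈ span R' {g x} := by
  have := hg.mem_span_iff x x y hx hx hy
  simpa using this

/-- Relative to a vector `a`, a vector `x` off the line of `a` has a canonical image on the line
of `g x`: the one whose sum with `g a` lies on the line of `g (a + x)`. -/
theorem exists_lift {a x : V} (ha : a ≠ 0) (hx : x ∉ span R {a}) :
    ∃ w, w ≠ 0 ∧ w ∈ span R' {g x} ∧ g a + w ∈ span R' {g (a + x)} := by
  have hx0 : x ≠ 0 := by rintro rfl; exact hx (zero_mem _)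
  have hax0 : a + x ≠ 0 := by
    intro h
    apply hx
    rw [← neg_eq_of_add_eq_zero_right h]
    exact neg_mem (mem_span_singleton_self _)
  have h1 := (hg.mem_span_iff a x (a + x) ha hx0 hax0).1 (mem_span_pair.2 ⟨1, 1, by simp⟩)
  obtain ⟨α, β, h⟩ := mem_span_pair.1 h1
  have hα : α ≠ 0 := by
    rintro rfl
    rw [zero_smul, zero_add] at h
    have h3 : a + x ∈ span R {x} := by
      rw [hg.mem_span_singleton_iff hx0 hax0, ← h]
      exact smul_mem _ _ (mem_span_singleton_self _)
    have := (Submodule.add_mem_iff_left _ (mem_span_singleton_self x)).1 h3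
    exact hx (mem_span_of_mem_span ha this)
  have hβ : β ≠ 0 := by
    rintro rfl
    rw [zero_smul, add_zero] at h
    have h3 : a + x ∈ span R {a} := by
      rw [hg.mem_span_singleton_iff ha hax0, ← h]
      exact smul_mem _ _ (mem_span_singleton_self _)
    exact hx ((Submodule.add_mem_iff_right _ (mem_span_singleton_self a)).1 h3)
  refine ⟨(α⁻¹ * β) • g x, ?_, smul_mem _ _ (mem_span_singleton_self _), ?_⟩
  · rw [smul_ne_zero_iff]
    exact ⟨mul_ne_zero (inv_ne_zero hα) hβ, hg.ne_zero x hx0⟩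
  · refine mem_span_singleton.2 ⟨α⁻¹, ?_⟩
    rw [← h, smul_add, smul_smul, smul_smul, inv_mul_cancel₀ hα, one_smul]

/-- On a line other than that of `g z`, at most one vector added to `g a` lies on the line of
`g z`. -/
theorem lift_unique {a z x : V} {w w' : V'} (hx : x ≠ 0) (hz : z ≠ 0) (hxz : x ∉ span R {z})
    (hw : w ∈ span R' {g x}) (hw' : w' ∈ span R' {g x})
    (h : g a + w ∈ span R' {g z}) (h' : g a + w' ∈ span R' {g z}) : w = w' := by
  by_contra hne
  have h1 : w - w' ∈ span R' {g x} := sub_mem hw hw'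
  have h3 : w - w' ∈ span R' {g z} := by
    have := sub_mem h h'
    rwa [add_sub_add_left_eq_sub] at this
  have h4 := mem_span_of_mem_span (sub_ne_zero.2 hne) h1
  rw [hg.mem_span_singleton_iff hz hx] at hxz
  exact hxz (span_le.2 (by simpa using h3) h4)

/-- The canonical images add up for independent `a`, `x`, `y`: the point `a + x + y` is the
intersection of the lines joining `a + x` with `y` and `a + y` with `x`. -/
theorem lift_add {a x y : V} {w u t : V'} (ha : a ≠ 0) (hx : x ∉ span R {a})
    (hy : y ∉ span R {a, x})
    (hw0 : w ≠ 0) (hw : w ∈ span R' {g x}) (hw' : g a + w ∈ span R' {g (a + x)})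
    (hu0 : u ≠ 0) (hu : u ∈ span R' {g y}) (hu' : g a + u ∈ span R' {g (a + y)})
    (ht : t ∈ span R' {g (x + y)}) (ht' : g a + t ∈ span R' {g (a + (x + y))}) :
    t = w + u := by
  have hx0 : x ≠ 0 := by rintro rfl; exact hx (zero_mem _)
  have hy0 : y ≠ 0 := by rintro rfl; exact hy (zero_mem _)
  have ind : ∀ A B C : R, A • a + B • x + C • y = 0 → A = 0 ∧ B = 0 ∧ C = 0 :=
    fun A B C h => indep_triple ha hx hy h
  have hax : a + x ≠ 0 := fun h => one_ne_zero (ind 1 1 0 (by simpa using h)).1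
  have hay : a + y ≠ 0 := fun h => one_ne_zero (ind 1 0 1 (by simpa using h)).1
  have hxy : x + y ≠ 0 := fun h => one_ne_zero (ind 0 1 1 (by simpa using h)).2.1
  have haxy : a + (x + y) ≠ 0 := fun h =>
    one_ne_zero (ind 1 1 1 (by rw [← h]; simp [add_assoc])).1
  have hwx := mem_span_of_mem_span hw0 hw
  have huy := mem_span_of_mem_span hu0 hu
  have hga : g a ≠ 0 := hg.ne_zero a ha
  have hgx : g x ∉ span R' {g a} := by rwa [← hg.mem_span_singleton_iff ha hx0]
  have hgy : g y ∉ span R' {g a, g x} := by rwa [← hg.mem_span_iff a x y ha hx0 hy0]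
  have hwa : w ∉ span R' {g a} := fun h => hgx (span_le.2 (by simpa using h) hwx)
  have hua : u ∉ span R' {g a, w} := by
    intro h
    refine hgy (span_le.2 ?_ (span_le.2 (by simpa using h) huy))
    rintro _ (rfl | rfl)
    · exact subset_span (by simp)
    · exact span_mono (by simp) hw
  have ind' : ∀ {A B C : R'}, A • g a + B • w + C • u = 0 → A = 0 ∧ B = 0 ∧ C = 0 :=
    fun h => indep_triple hga hwa hua h
  have haw0 : g a + w ≠ 0 := fun h => one_ne_zero (ind' (A := 1) (B := 1) (C := 0)
    (by simpa using h)).1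
  have hau0 : g a + u ≠ 0 := fun h => one_ne_zero (ind' (A := 1) (B := 0) (C := 1)
    (by simpa using h)).1
  have h1 : g a + t ∈ span R' {g a + w, u} := by
    have h := (hg.mem_span_iff (a + x) y (a + (x + y)) hax hy0 haxy).1
      (mem_span_pair.2 ⟨1, 1, by simp [add_assoc]⟩)
    refine span_le.2 ?_ (span_le.2 (by simpa using h) ht')
    rintro _ (rfl | rfl)
    · exact span_mono (by simp) (mem_span_of_mem_span haw0 hw')
    · exact span_mono (by simp) huy
  have h2 : g a + t ∈ span R' {g a + u, w} := by
    have h := (hg.mem_span_iff (a + y) x (a + (x + y)) hay hx0 haxy).1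
      (mem_span_pair.2 ⟨1, 1, by rw [one_smul, one_smul]; abel⟩)
    refine span_le.2 ?_ (span_le.2 (by simpa using h) ht')
    rintro _ (rfl | rfl)
    · exact span_mono (by simp) (mem_span_of_mem_span hau0 hu')
    · exact span_mono (by simp) hwx
  have h3 : t ∈ span R' {w, u} := by
    have h := (hg.mem_span_iff x y (x + y) hx0 hy0 hxy).1
      (mem_span_pair.2 ⟨1, 1, by simp⟩)
    refine span_le.2 ?_ (span_le.2 (by simpa using h) ht)
    rintro _ (rfl | rfl)
    · exact span_mono (by simp) hwx
    · exact span_mono (by simp) huy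
  obtain ⟨α, β, e1⟩ := mem_span_pair.1 h1
  obtain ⟨γ, δ, e2⟩ := mem_span_pair.1 h2
  obtain ⟨ε, ζ, e3⟩ := mem_span_pair.1 h3
  -- Compare coefficients with respect to `g a`, `w` and `u`.
  have i1 := ind' (A := α - 1) (B := α - ε) (C := β - ζ) (by
    have : α • (g a + w) + β • u - (g a + (ε • w + ζ • u)) = 0 := by rw [e1, e3, sub_self]
    rw [← this]; simp only [sub_smul, smul_add, one_smul]; abel)
  have i2 := ind' (A := γ - 1) (B := δ - ε) (C := γ - ζ) (by
    have : γ • (g a + u) + δ • w - (g a + (ε • w + ζ • u)) = 0 := by rw [e2, e3, sub_self]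
    rw [← this]; simp only [sub_smul, smul_add, one_smul]; abel)
  have hε : ε = 1 := by rw [← sub_eq_zero.1 i1.2.1, sub_eq_zero.1 i1.1]
  have hζ : ζ = 1 := by rw [← sub_eq_zero.1 i2.2.2, sub_eq_zero.1 i2.1]
  rw [← e3, hε, hζ, one_smul, one_smul]

/-- The canonical images relative to a vector `a` fit together to an additive map on the kernel of
a linear form that does not vanish at `a`. -/
theorem exists_additive_lift (hV : 3 ≤ finrank R V) {a : V} {χ : V →ₗ[R] R} (hχ : χ a = 1) :
    ∃ l : V → V', l 0 = 0 ∧ ∀ x, χ x = 0 → (x ≠ 0 → l x ≠ 0 ∧ l x ∈ span R' {g x}) ∧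
      g a + l x ∈ span R' {g (a + x)} ∧ ∀ y, χ y = 0 → l (x + y) = l x + l y := by
  classical
  have ha : a ≠ 0 := by rintro rfl; simp at hχ
  have hnot : ∀ x, χ x = 0 → x ≠ 0 → x ∉ span R {a} := by
    intro x hx hx0 h
    obtain ⟨c, rfl⟩ := mem_span_singleton.1 h
    rw [map_smul, hχ, smul_eq_mul, mul_one] at hx
    simp [hx] at hx0
  have hnot' : ∀ x y, χ x = 0 → χ y = 0 → y ∉ span R {x} → y ∉ span R {a, x} := by
    intro x y hx hy hyx h
    obtain ⟨c, d, rfl⟩ := mem_span_pair.1 h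
    rw [map_add, map_smul, map_smul, hx, hχ, smul_zero, add_zero, smul_eq_mul, mul_one] at hy
    apply hyx
    rw [hy, zero_smul, zero_add]
    exact smul_mem _ _ (mem_span_singleton_self _)
  have hex : ∀ x, ∃ w, (x = 0 → w = 0) ∧ (x ∉ span R {a} →
      w ≠ 0 ∧ w ∈ span R' {g x} ∧ g a + w ∈ span R' {g (a + x)}) := by
    intro x
    by_cases hx : x ∈ span R {a}
    · exact ⟨0, fun _ => rfl, fun h => absurd hx h⟩
    · obtain ⟨w, h⟩ := hg.exists_lift ha hx
      exact ⟨w, fun h0 => absurd (h0 ▸ zero_mem _) hx, fun _ => h⟩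
  choose l hl0 hl using hex
  have hl00 : l 0 = 0 := hl0 0 rfl
  have hadd : ∀ x y, χ x = 0 → χ y = 0 → y ∉ span R {x} → l (x + y) = l x + l y := by
    intro x y hx hy hyx
    by_cases hx0 : x = 0
    · rw [hx0, hl00, zero_add, zero_add]
    have hy0 : y ≠ 0 := by rintro rfl; exact hyx (zero_mem _)
    have hxy0 : x + y ≠ 0 := by
      intro h
      apply hyx
      rw [← neg_eq_of_add_eq_zero_right h]
      exact neg_mem (mem_span_singleton_self _)
    obtain ⟨h1, h2, h3⟩ := hl x (hnot x hx hx0)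
    obtain ⟨h4, h5, h6⟩ := hl y (hnot y hy hy0)
    obtain ⟨h7, h8, h9⟩ := hl (x + y) (hnot _ (by rw [map_add, hx, hy, add_zero]) hxy0)
    exact hg.lift_add ha (hnot x hx hx0) (hnot' x y hx hy hyx) h1 h2 h3 h4 h5 h6 h8 h9
  refine ⟨l, hl00, fun x hx => ⟨fun hx0 => ?_, ?_, fun y hy => ?_⟩⟩
  · exact ⟨(hl x (hnot x hx hx0)).1, (hl x (hnot x hx hx0)).2.1⟩
  · by_cases hx0 : x = 0
    · rw [hx0, hl00, add_zero, add_zero]; exact mem_span_singleton_self _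
    · exact (hl x (hnot x hx hx0)).2.2
  · by_cases hyx : y ∈ span R {x}
    · by_cases hx0 : x = 0
      · rw [hx0, hl00, zero_add, zero_add]
      -- A third vector `z` of the hyperplane off the line of `x` and `y`.
      have : FiniteDimensional R V := FiniteDimensional.of_finrank_pos (by omega)
      obtain ⟨z, hz, hzx⟩ : ∃ z, χ z = 0 ∧ z ∉ span R {x} := by
        have h1 := finrank_span_singleton (K := R) hx0
        have h2 := χ.finrank_range_add_finrank_ker
        have h3 := Submodule.finrank_le (LinearMap.range χ)
        rw [Module.finrank_self] at h3
        exact exists_mem_notMem_of_finrank_lt (U := LinearMap.ker χ) (W := span R {x}) (by omega)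
      have hyle : span R {y} ≤ span R {x} := span_le.2 (by simpa using hyx)
      have hxyle : span R {x + y} ≤ span R {x} :=
        span_le.2 (by simpa using add_mem (mem_span_singleton_self x) hyx)
      have e1 := hadd (x + y) z (by rw [map_add, hx, hy, add_zero]) hz fun h => hzx (hxyle h)
      have e2 := hadd x (y + z) hx (by rw [map_add, hy, hz, add_zero]) fun h =>
        hzx ((Submodule.add_mem_iff_right _ hyx).1 h)
      have e3 := hadd y z hy hz fun h => hzx (hyle h)
      rw [← add_assoc, e1, e3, ← add_assoc] at e2
      exact add_right_cancel e2
    · exact hadd x y hx hy hyx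

/-- The scalar factors by which an additive lift distorts multiples do not depend on the vector,
and they form a ring isomorphism. -/
theorem exists_ringEquiv (hV : 3 ≤ finrank R V) {a : V} {χ : V →ₗ[R] R} (hχ : χ a = 1)
    {l : V → V'} (hl0 : l 0 = 0)
    (hl : ∀ x, χ x = 0 → (x ≠ 0 → l x ≠ 0 ∧ l x ∈ span R' {g x}) ∧
      g a + l x ∈ span R' {g (a + x)} ∧ ∀ y, χ y = 0 → l (x + y) = l x + l y) :
    ∃ σ : R ≃+* R', ∀ x, χ x = 0 → ∀ c : R, l (c • x) = σ c • l x := by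
  have ha : a ≠ 0 := by rintro rfl; simp at hχ
  have hχs : ∀ (c : R) (x : V), χ x = 0 → χ (c • x) = 0 := fun c x hx => by simp [hx]
  have hex : ∀ (x : V) (c : R), ∃ d : R', (χ x = 0 → x ≠ 0 → l (c • x) = d • l x) := by
    intro x c
    by_cases h : χ x = 0 ∧ x ≠ 0
    · obtain ⟨hx, hx0⟩ := h
      obtain ⟨h1, h2⟩ := (hl x hx).1 hx0
      have hgl := mem_span_of_mem_span h1 h2
      by_cases hc : c = 0
      · exact ⟨0, fun _ _ => by rw [hc, zero_smul, zero_smul, hl0]⟩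
      · have hcx : c • x ≠ 0 := smul_ne_zero hc hx0
        have h3 := ((hl _ (hχs c x hx)).1 hcx).2
        have h4 := (hg.mem_span_singleton_iff hx0 hcx).1 (smul_mem _ c (mem_span_singleton_self x))
        have h5 := span_le.2 (by simpa using span_le.2 (by simpa using hgl) h4) h3
        obtain ⟨d, hd⟩ := mem_span_singleton.1 h5
        exact ⟨d, fun _ _ => hd.symm⟩
    · exact ⟨0, fun h1 h2 => absurd ⟨h1, h2⟩ h⟩
  choose s hs using hex
  have hindep : ∀ x y, χ x = 0 → χ y = 0 → x ≠ 0 → y ∉ span R {x} → ∀ c, s x c = s y c := by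
    intro x y hx hy hx0 hyx c
    have hy0 : y ≠ 0 := by rintro rfl; exact hyx (zero_mem _)
    have hxy0 : x + y ≠ 0 := by
      intro h
      apply hyx
      rw [← neg_eq_of_add_eq_zero_right h]
      exact neg_mem (mem_span_singleton_self _)
    have hxy : χ (x + y) = 0 := by rw [map_add, hx, hy, add_zero]
    have e := hs (x + y) c hxy hxy0
    rw [smul_add, (hl _ (hχs c x hx)).2.2 _ (hχs c y hy), hs x c hx hx0, hs y c hy hy0,
      (hl x hx).2.2 y hy, smul_add] at e
    obtain ⟨h1, h2⟩ := (hl x hx).1 hx0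
    obtain ⟨h3, h4⟩ := (hl y hy).1 hy0
    have hly : l y ∉ span R' {l x} := by
      intro h
      have h5 : l y ∈ span R' {g x} := span_le.2 (by simpa using h2) h
      rw [hg.mem_span_singleton_iff hx0 hy0] at hyx
      exact hyx (span_le.2 (by simpa using h5) (mem_span_of_mem_span h3 h4))
    have h6 : (s y c - s (x + y) c) = 0 := by
      by_contra hne
      apply hly
      have h7 : (s y c - s (x + y) c) • l y = (s (x + y) c - s x c) • l x := by
        rw [sub_smul, sub_smul, sub_eq_sub_iff_add_eq_add, add_comm, e, add_comm]
      have : l y = (s y c - s (x + y) c)⁻¹ • ((s y c - s (x + y) c) • l y) := by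
        rw [smul_smul, inv_mul_cancel₀ hne, one_smul]
      rw [this, h7]
      exact smul_mem _ _ (smul_mem _ _ (mem_span_singleton_self _))
    rw [sub_eq_zero] at h6
    rw [← h6, add_left_inj] at e
    exact smul_left_injective R' h1 e
  have : FiniteDimensional R V := FiniteDimensional.of_finrank_pos (by omega)
  have hker : 2 ≤ finrank R (LinearMap.ker χ) := by
    have h2 := χ.finrank_range_add_finrank_ker
    have h3 := Submodule.finrank_le (LinearMap.range χ)
    rw [Module.finrank_self] at h3
    omega
  have hoff : ∀ x, χ x = 0 → x ≠ 0 → ∃ z, χ z = 0 ∧ z ∉ span R {x} := fun x hx hx0 =>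
    exists_mem_notMem_of_finrank_lt (U := LinearMap.ker χ) (W := span R {x})
      (by rw [finrank_span_singleton hx0]; omega)
  obtain ⟨e, he, he0⟩ : ∃ e, χ e = 0 ∧ e ≠ 0 := by
    obtain ⟨z, hz, hz'⟩ := exists_mem_notMem_of_finrank_lt (U := LinearMap.ker χ)
      (W := (⊥ : Submodule R V)) (by rw [finrank_bot]; omega)
    exact ⟨z, hz, fun h => hz' (by simpa using h)⟩
  have hle : l e ≠ 0 := ((hl e he).1 he0).1
  have hconst : ∀ x, χ x = 0 → x ≠ 0 → ∀ c, s x c = s e c := by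
    intro x hx hx0 c
    by_cases h : x ∈ span R {e}
    · obtain ⟨z, hz, hze⟩ := hoff e he he0
      rw [hindep e z he hz he0 hze]
      exact hindep x z hx hz hx0 (fun h' => hze (span_le.2 (by simpa using h) h')) c
    · exact (hindep e x he hx he0 h c).symm
  have hsemi : ∀ x, χ x = 0 → ∀ c, l (c • x) = s e c • l x := by
    intro x hx c
    by_cases hx0 : x = 0
    · rw [hx0, smul_zero, hl0, smul_zero]
    · rw [hs x c hx hx0, hconst x hx hx0]
  have hinj : ∀ {c d : R'}, c • l e = d • l e → c = d := fun h => smul_left_injective R' hle h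
  let σ : R →+* R' :=
    { toFun := s e
      map_one' := hinj (by rw [← hsemi e he, one_smul, one_smul])
      map_mul' := fun c d => hinj (by
        rw [← hsemi e he, mul_smul, hsemi _ (hχs d e he), hsemi e he, mul_smul])
      map_zero' := hinj (by rw [← hsemi e he, zero_smul, zero_smul, hl0])
      map_add' := fun c d => hinj (by
        rw [← hsemi e he, add_smul, add_smul, (hl _ (hχs c e he)).2.2 _ (hχs d e he),
          hsemi e he, hsemi e he]) }
  have hsurj : Function.Surjective σ := by
    intro d
    have hle' := ((hl e he).1 he0).2
    have hga : g a ∉ span R' {g e} := by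
      rw [← hg.mem_span_singleton_iff he0 ha]
      intro h
      obtain ⟨c, rfl⟩ := mem_span_singleton.1 h
      rw [map_smul, he, smul_zero] at hχ
      exact zero_ne_one hχ
    have hne : g a + d • l e ≠ 0 := by
      intro h
      apply hga
      rw [eq_neg_of_add_eq_zero_left h]
      exact neg_mem (smul_mem _ _ hle')
    obtain ⟨z, hz0, hz⟩ := hg.surjective _ hne
    have hz' := mem_span_of_mem_span hne hz
    have hzae : z ∈ span R {a, e} := by
      rw [hg.mem_span_iff a e z ha he0 hz0]
      refine span_le.2 ?_ hz'
      rintro _ rfl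
      exact add_mem (subset_span (by simp)) (smul_mem _ _ (span_mono (by simp) hle'))
    obtain ⟨α, β, hαβ⟩ := mem_span_pair.1 hzae
    have hα : α ≠ 0 := by
      rintro rfl
      apply hga
      rw [zero_smul, zero_add] at hαβ
      have h1 : z ∈ span R {e} := hαβ ▸ smul_mem _ _ (mem_span_singleton_self _)
      rw [hg.mem_span_singleton_iff he0 hz0] at h1
      have h3 := span_le.2 (by simpa using h1) hz
      exact (Submodule.add_mem_iff_left _ (smul_mem _ _ hle')).1 h3
    -- The line of `z` is that of `a + c • e`, whose image passes through `g a + σ c • l e`.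
    have hzc : a + (α⁻¹ * β) • e = α⁻¹ • z := by
      rw [← hαβ, smul_add, smul_smul, smul_smul, inv_mul_cancel₀ hα, one_smul]
    have hz1 : α⁻¹ • z ≠ 0 := smul_ne_zero (inv_ne_zero hα) hz0
    have h1 := (hl _ (hχs (α⁻¹ * β) e he)).2.1
    rw [hzc, hsemi e he] at h1
    have h3 : g (α⁻¹ • z) ∈ span R' {g z} :=
      (hg.mem_span_singleton_iff hz0 hz1).1 (smul_mem _ _ (mem_span_singleton_self _))
    have h4 : g a + s e (α⁻¹ * β) • l e ∈ span R' {g z} := span_le.2 (by simpa using h3) h1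
    have hez : e ∉ span R {z} := by
      intro h
      have h5 := mem_span_of_mem_span he0 h
      rw [← hαβ, Submodule.add_mem_iff_left _ (smul_mem _ _ (mem_span_singleton_self _))] at h5
      have h6 := smul_mem _ α⁻¹ h5
      rw [smul_smul, inv_mul_cancel₀ hα, one_smul, hg.mem_span_singleton_iff he0 ha] at h6
      exact hga h6
    exact ⟨α⁻¹ * β, hinj (hg.lift_unique he0 hz0 hez (smul_mem _ _ hle') (smul_mem _ _ hle') h4 hz)⟩
  exact ⟨RingEquiv.ofBijective σ ⟨σ.injective, hsurj⟩, hsemi⟩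

/-- **Fundamental theorem of projective geometry**: a collineation in dimension at least three is
induced by a semilinear bijection. -/
theorem exists_semilinear (hV : 3 ≤ finrank R V) :
    ∃ (σ : R ≃+* R') (L : V ≃+ V'), (∀ (c : R) (x : V), L (c • x) = σ c • L x) ∧
      ∀ x, x ≠ 0 → L x ∈ span R' {g x} := by
  have : FiniteDimensional R V := FiniteDimensional.of_finrank_pos (by omega)
  obtain ⟨a₀, -, ha₀⟩ := exists_mem_notMem_of_finrank_lt (U := (⊤ : Submodule R V))
    (W := (⊥ : Submodule R V)) (by rw [finrank_bot, finrank_top]; omega)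
  obtain ⟨χ₀, hχ₀, -⟩ := Submodule.exists_le_ker_of_notMem ha₀
  obtain ⟨a, χ, hχ⟩ : ∃ (a : V) (χ : V →ₗ[R] R), χ a = 1 :=
    ⟨(χ₀ a₀)⁻¹ • a₀, χ₀, by simp [hχ₀]⟩
  clear ha₀ hχ₀
  have ha : a ≠ 0 := by rintro rfl; simp at hχ
  obtain ⟨l, hl0, hl⟩ := hg.exists_additive_lift hV hχ
  obtain ⟨σ, hσ⟩ := hg.exists_ringEquiv hV hχ hl0 hl
  have hker : ∀ x, χ (x - χ x • a) = 0 := fun x => by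
    rw [map_sub, map_smul, hχ, smul_eq_mul, mul_one, sub_self]
  let L : V →+ V' := AddMonoidHom.mk' (fun x => σ (χ x) • g a + l (x - χ x • a)) (by
    intro x y
    have : x + y - χ (x + y) • a = (x - χ x • a) + (y - χ y • a) := by
      rw [map_add, add_smul]; abel
    rw [this, (hl _ (hker x)).2.2 _ (hker y), map_add χ, map_add σ, add_smul]
    abel)
  have hL : ∀ x, L x = σ (χ x) • g a + l (x - χ x • a) := fun _ => rfl
  have hLsmul : ∀ (c : R) (x : V), L (c • x) = σ c • L x := by
    intro c x
    have : c • x - χ (c • x) • a = c • (x - χ x • a) := by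
      rw [map_smul, smul_eq_mul, mul_smul, smul_sub]
    rw [hL, this, hσ _ (hker x), hL, smul_add, smul_smul, map_smul, smul_eq_mul, map_mul]
  have hLmem : ∀ x, x ≠ 0 → L x ≠ 0 ∧ L x ∈ span R' {g x} := by
    intro x hx
    by_cases h0 : χ x = 0
    · have : L x = l x := by rw [hL, h0, zero_smul, sub_zero, map_zero, zero_smul, zero_add]
      rw [this]
      exact (hl x h0).1 hx
    · have hx' : x = χ x • (a + (χ x)⁻¹ • (x - χ x • a)) := by
        rw [smul_add, smul_smul, mul_inv_cancel₀ h0, one_smul]; abel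
      set y := (χ x)⁻¹ • (x - χ x • a) with hy
      have hχy : χ y = 0 := by rw [hy, map_smul, hker, smul_zero]
      have hLx : L x = σ (χ x) • (g a + l y) := by
        conv_lhs => rw [hx']
        rw [hLsmul, hL, map_add, hχ, hχy, add_zero, map_one, one_smul, one_smul,
          add_sub_cancel_left]
      have hay0 : a + y ≠ 0 := by
        intro h
        rw [h, smul_zero] at hx'
        exact hx hx'
      have hσ0 : σ (χ x) ≠ 0 := by simpa using h0
      constructor
      · rw [hLx]
        refine smul_ne_zero hσ0 fun h => ?_
        have hgal : g a = -l y := eq_neg_of_add_eq_zero_left h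
        have hy0 : y ≠ 0 := by
          intro hy0
          rw [hy0, hl0, neg_zero] at hgal
          exact hg.ne_zero a ha hgal
        have h1 : g a ∈ span R' {g y} := hgal ▸ neg_mem ((hl y hχy).1 hy0).2
        rw [← hg.mem_span_singleton_iff hy0 ha] at h1
        obtain ⟨c, hc⟩ := mem_span_singleton.1 h1
        rw [← hc, map_smul, hχy, smul_zero] at hχ
        exact zero_ne_one hχ
      · rw [hLx]
        refine smul_mem _ _ (span_le.2 ?_ (hl y hχy).2.1)
        have h1 : a + y ∈ span R {x} := mem_span_of_mem_span hx
          (by rw [hx']; exact smul_mem _ _ (mem_span_singleton_self _))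
        simpa using (hg.mem_span_singleton_iff hx hay0).1 h1
  have hLinj : Function.Injective L := by
    rw [injective_iff_map_eq_zero]
    intro x hx
    by_contra hx0
    exact (hLmem x hx0).1 hx
  have hLsurj : Function.Surjective L := by
    intro y
    by_cases hy : y = 0
    · exact ⟨0, by rw [hy, map_zero]⟩
    obtain ⟨z, hz0, hz⟩ := hg.surjective y hy
    obtain ⟨h1, h2⟩ := hLmem z hz0
    have h3 := span_le.2 (by simpa using mem_span_of_mem_span h1 h2) hz
    obtain ⟨c, hc⟩ := mem_span_singleton.1 h3
    exact ⟨σ.symm c • z, by rw [hLsmul, RingEquiv.apply_symm_apply, hc]⟩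
  exact ⟨σ, AddEquiv.ofBijective L ⟨hLinj, hLsurj⟩, hLsmul, fun x hx => (hLmem x hx).2⟩

end IsCollineation

end Projective

/-! ### Bijections of line projections and semilinear maps -/

section Induced

open Module Submodule

variable {R R' V V' : Type*} [DivisionRing R] [DivisionRing R'] [AddCommGroup V] [Module R V]
  [AddCommGroup V'] [Module R' V']

theorem form_vec_eq_zero_of_map (G : lineProjections R V → lineProjections R' V')
    (hr : ∀ p q, SameRange p q → SameRange (G p) (G q))
    (hk : ∀ p q, SameKer p q → SameKer (G p) (G q)) {p q : lineProjections R V}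
    (h : form (G p) (vec (G q)) = 0) : form p (vec q) = 0 := by
  by_contra hne
  -- Otherwise some projection has the range of `q` and the kernel of `p`.
  obtain ⟨c, hc, hvec⟩ := exists_vec_lineProj hne
  have h1 : SameRange q (lineProj (vec q) (form p) hne) := by
    rw [sameRange_iff, hvec]
    exact smul_mem _ _ (mem_span_singleton_self _)
  have h2 : SameKer p (lineProj (vec q) (form p) hne) := by
    rw [sameKer_iff]
    exact fun v hv => (form_lineProj_eq_zero hne).2 hv
  obtain ⟨d, hd⟩ := mem_span_singleton.1 (sameRange_iff.1 (hr _ _ h1))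
  have h3 := sameKer_iff.1 (hk _ _ h2) _ h
  have h4 := form_vec (G (lineProj (vec q) (form p) hne))
  rw [← hd, map_smul, h3, smul_zero] at h4
  exact zero_ne_one h4

/-- The kernel of `p` contains the range of `q` precisely if this holds for their images under a
bijection that respects equality of ranges and of kernels. -/
theorem form_vec_eq_zero_iff (G : lineProjections R V ≃ lineProjections R' V')
    (hr : ∀ p q, SameRange p q ↔ SameRange (G p) (G q))
    (hk : ∀ p q, SameKer p q ↔ SameKer (G p) (G q)) (p q : lineProjections R V) :
    form p (vec q) = 0 ↔ form (G p) (vec (G q)) = 0 := by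
  refine ⟨fun h => form_vec_eq_zero_of_map G.symm ?_ ?_ (by simpa using h),
    form_vec_eq_zero_of_map G (fun p q => (hr p q).1) (fun p q => (hk p q).1)⟩
  · intro p q h; rw [hr]; simpa using h
  · intro p q h; rw [hk]; simpa using h

theorem vec_mem_span_of_equiv (G : lineProjections R V ≃ lineProjections R' V')
    (hr : ∀ p q, SameRange p q ↔ SameRange (G p) (G q))
    (hk : ∀ p q, SameKer p q ↔ SameKer (G p) (G q)) {p q r : lineProjections R V}
    (hpqr : vec r ∈ span R {vec p, vec q}) :
    vec (G r) ∈ span R' {vec (G p), vec (G q)} := by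
  by_contra hne
  obtain ⟨ψ, hψ, hle⟩ := Submodule.exists_le_ker_of_notMem hne
  have hmem : ∀ z ∈ ({vec (G p), vec (G q)} : Set V'), ψ z = 0 := fun z hz =>
    hle (subset_span hz)
  obtain ⟨s, hs⟩ := G.surjective (lineProj (vec (G r)) ψ hψ)
  have h1 : form s (vec p) = 0 := by
    rw [form_vec_eq_zero_iff G hr hk, hs, form_lineProj_eq_zero]
    exact hmem _ (by simp)
  have h2 : form s (vec q) = 0 := by
    rw [form_vec_eq_zero_iff G hr hk, hs, form_lineProj_eq_zero]
    exact hmem _ (by simp)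
  have h3 : form s (vec r) ≠ 0 := by
    rw [Ne, form_vec_eq_zero_iff G hr hk, hs, form_lineProj_eq_zero]
    exact hψ
  obtain ⟨a, b, hab⟩ := mem_span_pair.1 hpqr
  apply h3
  rw [← hab, map_add, map_smul, map_smul, h1, h2, smul_zero, smul_zero, add_zero]

theorem exists_lineProjection_vec_mem_span {x : V} (hx : x ≠ 0) :
    ∃ p : lineProjections R V, vec p ∈ span R {x} := by
  obtain ⟨φ, hφ, -⟩ := Submodule.exists_le_ker_of_notMem (K := R) (p := ⊥) (v := x)
    (by simpa using hx)
  obtain ⟨c, -, h⟩ := exists_vec_lineProj hφ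
  exact ⟨lineProj x φ hφ, by rw [h]; exact smul_mem _ _ (mem_span_singleton_self _)⟩

/-- A bijection between the line projections of two spaces that respects equality of ranges and
of kernels is the conjugation by a semilinear bijection. -/
theorem exists_semilinear_conj (hV : 3 ≤ finrank R V)
    (G : lineProjections R V ≃ lineProjections R' V')
    (hr : ∀ p q, SameRange p q ↔ SameRange (G p) (G q))
    (hk : ∀ p q, SameKer p q ↔ SameKer (G p) (G q)) :
    ∃ (σ : R ≃+* R') (L : V ≃+ V'), (∀ (c : R) (x : V), L (c • x) = σ c • L x) ∧
      ∀ (p : lineProjections R V) (v : V), L (p.1 v) = (G p).1 (L v) := by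
  have hex : ∀ x : V, ∃ w : V', x ≠ 0 → ∃ p : lineProjections R V, vec p ∈ span R {x} ∧
      w = vec (G p) := by
    intro x
    by_cases hx : x = 0
    · exact ⟨0, fun h => absurd hx h⟩
    · obtain ⟨p, hp⟩ := exists_lineProjection_vec_mem_span (R := R) hx
      exact ⟨_, fun _ => ⟨p, hp, rfl⟩⟩
  choose g hg using hex
  have hg1 : ∀ x, x ≠ 0 → ∀ p : lineProjections R V, vec p ∈ span R {x} →
      vec (G p) ∈ span R' {g x} := by
    intro x hx p hp
    obtain ⟨q, hq, he⟩ := hg x hx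
    rw [he, ← sameRange_iff, ← hr, sameRange_iff]
    have := mem_span_of_mem_span (vec_ne_zero q) hq
    exact span_le.2 (by simpa using this) hp
  have hspan_eq : ∀ {x y : V}, x ≠ 0 → x ∈ span R {y} → span R {x} = span R {y} := by
    intro x y hx h
    exact le_antisymm (span_le.2 (by simpa using h))
      (span_le.2 (by simpa using mem_span_of_mem_span hx h))
  have hcol : IsCollineation R R' g := by
    refine ⟨fun x hx => ?_, fun x y z hx hy hz => ?_, fun y hy => ?_⟩
    · obtain ⟨p, -, he⟩ := hg x hx
      rw [he]
      exact vec_ne_zero _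
    · obtain ⟨p, hp, hp'⟩ := hg x hx
      obtain ⟨q, hq, hq'⟩ := hg y hy
      obtain ⟨r, hr1, hr'⟩ := hg z hz
      rw [hp', hq', hr']
      have e1 : span R {x, y} = span R {vec p, vec q} := by
        rw [span_insert, span_insert, ← hspan_eq (vec_ne_zero p) hp,
          ← hspan_eq (vec_ne_zero q) hq]
      have e2 : z ∈ span R {x, y} ↔ vec r ∈ span R {vec p, vec q} := by
        rw [e1]
        have := hspan_eq (vec_ne_zero r) hr1
        rw [← span_singleton_le_iff_mem, ← this, span_singleton_le_iff_mem]
      rw [e2]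
      refine ⟨vec_mem_span_of_equiv G hr hk, fun h => ?_⟩
      have := vec_mem_span_of_equiv G.symm
        (fun p q => by rw [hr, G.apply_symm_apply, G.apply_symm_apply])
        (fun p q => by rw [hk, G.apply_symm_apply, G.apply_symm_apply]) h
      simpa using this
    · obtain ⟨q, hq⟩ := exists_lineProjection_vec_mem_span (R := R') hy
      refine ⟨vec (G.symm q), vec_ne_zero _, ?_⟩
      have := hg1 _ (vec_ne_zero _) (G.symm q) (mem_span_singleton_self _)
      rw [Equiv.apply_symm_apply] at this
      exact span_le.2 (by simpa using this) (mem_span_of_mem_span (vec_ne_zero q) hq)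
  obtain ⟨σ, L, hL, hLg⟩ := hcol.exists_semilinear hV
  refine ⟨σ, L, hL, fun p v => ?_⟩
  have hrange : (G p).1 (L (p.1 v)) = L (p.1 v) := by
    by_cases h0 : p.1 v = 0
    · rw [h0, map_zero, map_zero]
    · apply coe_apply_eq_self
      have h1 : vec p ∈ span R {p.1 v} := mem_span_of_mem_span h0
        (by rw [coe_apply]; exact smul_mem _ _ (mem_span_singleton_self _))
      have h2 := mem_span_of_mem_span (vec_ne_zero _) (hg1 _ h0 p h1)
      exact span_le.2 (by simpa using h2) (hLg _ h0)
  have hker : (G p).1 (L (v - p.1 v)) = 0 := by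
    by_cases h0 : v - p.1 v = 0
    · rw [h0, map_zero, map_zero]
    · obtain ⟨q, hq, hq'⟩ := hg _ h0
      have h1 := hLg _ h0
      rw [hq'] at h1
      obtain ⟨c, hc⟩ := mem_span_singleton.1 h1
      obtain ⟨d, hd⟩ := mem_span_singleton.1 hq
      rw [coe_apply_eq_zero, ← hc, map_smul, (form_vec_eq_zero_iff G hr hk p q).1, smul_zero]
      rw [← hd, map_smul, coe_apply_eq_zero.1 (coe_apply_sub p v), smul_zero]
  have : L v = L (p.1 v) + L (v - p.1 v) := by rw [← map_add, add_sub_cancel]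
  rw [this, map_add, hrange, hker, add_zero]

end Induced

/-! ### The dual space -/

section Dual

open Module MulOpposite

variable {R V : Type*} [DivisionRing R] [AddCommGroup V] [Module R V]

/-- The transpose of an endomorphism `u` of `V`: the endomorphism `χ ↦ χ ∘ u` of the dual space
`V →ₗ[R] R`, which is a left vector space over the opposite ring. -/
def transpose (u : End R V) : End Rᵐᵒᵖ (V →ₗ[R] R) where
  toFun χ := χ ∘ₗ u
  map_add' _ _ := rfl
  map_smul' _ _ := rfl

theorem transpose_apply (u : End R V) (χ : V →ₗ[R] R) : transpose u χ = χ ∘ₗ u := rfl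

theorem transpose_mul (u w : End R V) : transpose (u * w) = transpose w * transpose u := rfl

theorem transpose_injective : Function.Injective (transpose (R := R) (V := V)) := by
  intro u w h
  ext v
  by_contra hne
  obtain ⟨χ, hχ, -⟩ := Submodule.exists_le_ker_of_notMem (K := R) (p := ⊥) (v := u v - w v)
    (by simpa [sub_eq_zero] using hne)
  have := LinearMap.congr_fun (LinearMap.congr_fun h χ) v
  simp only [transpose_apply, LinearMap.comp_apply] at this
  exact hχ (by rw [map_sub, this, sub_self])

/-- The expansion of a linear form in the dual basis; the coefficients act from the right. -/
theorem form_eq_sum {ι : Type*} [Fintype ι] (b : Basis ι R V) (χ : V →ₗ[R] R) :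
    χ = ∑ i, op (χ (b i)) • b.coord i := by
  classical
  refine b.ext fun j => ?_
  rw [LinearMap.sum_apply, Finset.sum_eq_single j]
  · simp
  · intro i _ hij
    simp [hij.symm]
  · simp

theorem transpose_surjective [FiniteDimensional R V] :
    Function.Surjective (transpose (R := R) (V := V)) := by
  intro h
  let b := finBasis R V
  refine ⟨∑ i, LinearMap.toSpanSingleton R V (b i) ∘ₗ h (b.coord i), ?_⟩
  ext χ v
  conv_rhs => rw [form_eq_sum b χ, map_sum]
  simp [transpose_apply]

theorem transpose_mem_lineProjections [FiniteDimensional R V] {p : End R V} :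
    transpose p ∈ lineProjections Rᵐᵒᵖ (V →ₗ[R] R) ↔ p ∈ lineProjections R V := by
  constructor
  · rintro ⟨φ, e, he, hp⟩
    let b := finBasis R V
    have hex : ∀ χ, e χ = op (χ (∑ i, unop (e (b.coord i)) • b i)) := by
      intro χ
      conv_lhs => rw [form_eq_sum b χ, map_sum]
      simp
    refine ⟨∑ i, unop (e (b.coord i)) • b i, φ, op_injective (by rw [← hex, he]; rfl), ?_⟩
    apply transpose_injective
    rw [hp]
    ext χ v
    simp only [LinearMap.comp_apply, LinearMap.toSpanSingleton_apply, transpose_apply]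
    rw [hex χ]
    simp
  · rintro ⟨x, φ, hx, rfl⟩
    let ev : (V →ₗ[R] R) →ₗ[Rᵐᵒᵖ] Rᵐᵒᵖ :=
      { toFun := fun χ => op (χ x)
        map_add' := fun _ _ => rfl
        map_smul' := fun c χ => by
          apply unop_injective
          simp }
    refine ⟨φ, ev, congrArg op hx, ?_⟩
    ext χ v
    simp [transpose_apply, ev]

/-- Transposition as an isomorphism onto the opposite of the endomorphism ring of the dual. -/
noncomputable def transposeEquiv [FiniteDimensional R V] :
    End R V ≃* (End Rᵐᵒᵖ (V →ₗ[R] R))ᵐᵒᵖ :=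
  MulEquiv.ofBijective
    ({ toFun := fun u => op (transpose u)
       map_one' := rfl
       map_mul' := fun _ _ => rfl } : End R V →* (End Rᵐᵒᵖ (V →ₗ[R] R))ᵐᵒᵖ)
    ⟨fun _ _ h => transpose_injective (op_injective h), fun h => by
      obtain ⟨u, hu⟩ := transpose_surjective (unop h)
      exact ⟨u, unop_injective hu⟩⟩

/-- Transposition maps the line projections of `V` bijectively onto those of its dual space. -/
noncomputable def transposeProjections [FiniteDimensional R V] :
    lineProjections R V ≃ lineProjections Rᵐᵒᵖ (V →ₗ[R] R) :=
  Equiv.ofBijective (fun p => ⟨transpose p.1, transpose_mem_lineProjections.2 p.2⟩)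
    ⟨fun _ _ h => Subtype.ext (transpose_injective (congrArg Subtype.val h)), fun q => by
      obtain ⟨u, hu⟩ := transpose_surjective q.1
      exact ⟨⟨u, transpose_mem_lineProjections.1 (hu ▸ q.2)⟩, Subtype.ext hu⟩⟩

theorem coe_transposeProjections [FiniteDimensional R V] (p : lineProjections R V) :
    (transposeProjections p).1 = transpose p.1 := rfl

theorem sameRange_transpose [FiniteDimensional R V] {p q : lineProjections R V} :
    SameRange (transposeProjections p) (transposeProjections q) ↔ SameKer p q := by
  rw [SameRange, SameKer, coe_transposeProjections, coe_transposeProjections, ← transpose_mul,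
    ← transpose_mul, transpose_injective.eq_iff, transpose_injective.eq_iff, and_comm]

theorem sameKer_transpose [FiniteDimensional R V] {p q : lineProjections R V} :
    SameKer (transposeProjections p) (transposeProjections q) ↔ SameRange p q := by
  rw [SameRange, SameKer, coe_transposeProjections, coe_transposeProjections, ← transpose_mul,
    ← transpose_mul, transpose_injective.eq_iff, transpose_injective.eq_iff, and_comm]

end Dual

/-! ### The automorphism of the general linear group -/

section Automorphism

open Module MulOpposite

variable {R R' V V' : Type*} [DivisionRing R] [DivisionRing R'] [AddCommGroup V] [Module R V]
  [AddCommGroup V'] [Module R' V'] {ι : Type*} [DecidableEq ι]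

/-- If `A` acts on the images under `L` of the vectors of `b` by the signs of `diag b S`, then `L`
intertwines `diag b S` and `A`. -/
theorem apply_eq_apply_diag [Fintype ι] {σ : R ≃+* R'} {L : V ≃+ V'}
    (hL : ∀ (c : R) (x : V), L (c • x) = σ c • L x) (b : Basis ι R V) (S : Finset ι)
    {A : End R' V'} (h : ∀ i, A (L (b i)) = if i ∈ S then L (b i) else -L (b i)) (v : V) :
    A (L v) = L (diag b S v) := by
  conv_lhs => rw [← b.sum_repr v]
  conv_rhs => rw [← b.sum_repr v]
  rw [map_sum, map_sum, map_sum, map_sum]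
  refine Finset.sum_congr rfl fun i _ => ?_
  rw [hL, map_smul, h, map_smul, hL, diag_apply]
  split_ifs <;> simp

theorem diag_mul_proj (b : Basis ι R V) (S : Finset ι) (i : ι) :
    diag b S * proj b i = if i ∈ S then proj b i else -proj b i := by
  ext v
  rw [Module.End.mul_apply, proj_apply, map_smul, diag_apply]
  split_ifs
  · rfl
  · rw [LinearMap.neg_apply, proj_apply, smul_neg]

theorem proj_mul_diag (b : Basis ι R V) (S : Finset ι) (i : ι) :
    proj b i * diag b S = if i ∈ S then proj b i else -proj b i := by
  ext v
  rw [Module.End.mul_apply, proj_apply, repr_diag]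
  split_ifs
  · rfl
  · rw [LinearMap.neg_apply, proj_apply, neg_smul]

/-- An additive bijection which is semilinear with respect to `σ`, as a semilinear equivalence. -/
def toSemilinearEquiv {σ : R ≃+* R'} {L : V ≃+ V'}
    (hL : ∀ (c : R) (x : V), L (c • x) = σ c • L x) :
    letI := RingHomInvPair.of_ringEquiv σ
    letI := RingHomInvPair.symm (σ : R →+* R') (σ.symm : R' →+* R)
    V ≃ₛₗ[(σ : R →+* R')] V' :=
  letI := RingHomInvPair.of_ringEquiv σ
  letI := RingHomInvPair.symm (σ : R →+* R') (σ.symm : R' →+* R)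
  { L with map_smul' := hL }

/-- Conjugation by a semilinear bijection, as an isomorphism of general linear groups. -/
def conjGL {σ : R ≃+* R'} {L : V ≃+ V'}
    (hL : ∀ (c : R) (x : V), L (c • x) = σ c • L x) :
    LinearMap.GeneralLinearGroup R V ≃* LinearMap.GeneralLinearGroup R' V' :=
  letI := RingHomInvPair.of_ringEquiv σ
  letI := RingHomInvPair.symm (σ : R →+* R') (σ.symm : R' →+* R)
  LinearMap.GeneralLinearGroup.congrLinearEquiv (toSemilinearEquiv hL)

theorem conjGL_apply {σ : R ≃+* R'} {L : V ≃+ V'}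
    (hL : ∀ (c : R) (x : V), L (c • x) = σ c • L x) (u : LinearMap.GeneralLinearGroup R V)
    (v : V) : (conjGL hL u : End R' V') (L v) = L ((u : End R V) v) := by
  change L ((u : End R V) (L.symm (L v))) = _
  rw [AddEquiv.symm_apply_apply]

theorem conjGL_eq_of_apply {σ : R ≃+* R'} {L : V ≃+ V'}
    (hL : ∀ (c : R) (x : V), L (c • x) = σ c • L x) {u : LinearMap.GeneralLinearGroup R V}
    {A : End R' V'} (h : ∀ v, A (L v) = L ((u : End R V) v)) :
    (conjGL hL u : End R' V') = A := by
  ext w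
  obtain ⟨v, rfl⟩ := L.surjective w
  rw [conjGL_apply, h]

/-- The automorphism of `GL(V)` that composes conjugation by a semilinear bijection onto the
dual space with inversion and transposition. -/
noncomputable def contragredient [FiniteDimensional R V] {σ : R ≃+* Rᵐᵒᵖ}
    {L : V ≃+ (V →ₗ[R] R)} (hL : ∀ (c : R) (x : V), L (c • x) = σ c • L x) :
    LinearMap.GeneralLinearGroup R V ≃* LinearMap.GeneralLinearGroup R V :=
  ((conjGL hL).trans (MulEquiv.inv' _)).trans
    ((Units.mapEquiv transposeEquiv).trans Units.opEquiv).symm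

theorem contragredient_eq_of_transpose [FiniteDimensional R V] {σ : R ≃+* Rᵐᵒᵖ}
    {L : V ≃+ (V →ₗ[R] R)} (hL : ∀ (c : R) (x : V), L (c • x) = σ c • L x)
    {u w : LinearMap.GeneralLinearGroup R V}
    (h : transpose (w : End R V) = ((conjGL hL u)⁻¹ : LinearMap.GeneralLinearGroup _ _)) :
    contragredient hL u = w := by
  rw [contragredient, MulEquiv.trans_apply, MulEquiv.symm_apply_eq, MulEquiv.trans_apply]
  apply unop_injective
  exact Units.ext h.symm

/-- The result for `(k, k)`-involutions of a space of dimension `2 * k`. -/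
theorem exists_mulEquiv_of_commutativityPreserving [FiniteDimensional R V] {k : ℕ}
    (h2 : (2 : R) ≠ 0) (hk : 4 ≤ k) (hV : finrank R V = 2 * k)
    (f : involutions R V k k ≃ involutions R V k k) (hf : CommutativityPreserving f) :
    ∃ f' : LinearMap.GeneralLinearGroup R V ≃* LinearMap.GeneralLinearGroup R V,
      ∀ u : involutions R V k k, (f u : LinearMap.GeneralLinearGroup R V) = f' u ∨
        (f u : LinearMap.GeneralLinearGroup R V) = -(f' u) := by
  have hι : Fintype.card (Fin (2 * k)) = 2 * k := Fintype.card_fin _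
  have hk0 : 0 < k := by omega
  obtain ⟨F, hF⟩ := exists_equiv_lineProjections h2 hι hk hV hf
  have hdiag : ∀ u : involutions R V k k, ∃ (b b' : Basis (Fin (2 * k)) R V)
      (S : {S : Finset (Fin (2 * k)) // S.card = k}), u = diagInv h2 hι b S ∧ IsImage f b b' := by
    intro u
    obtain ⟨b, hb⟩ := exists_diagInv_eq h2 hι hV (A := {u}) (by simp)
    obtain ⟨S, hS⟩ := hb u (by simp)
    obtain ⟨b', hb'⟩ := exists_isImage h2 hι hk hV hf b
    exact ⟨b, b', S, hS, hb'⟩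
  -- Only the involution `diag b S` has to be compared with `diag b' S`.
  have hfinal : ∀ f' : LinearMap.GeneralLinearGroup R V ≃* LinearMap.GeneralLinearGroup R V,
      (∀ (b b' : Basis (Fin (2 * k)) R V), IsImage f b b' → ∀ S, f' (diagGL b S) = diagGL b' S) →
      ∀ u : involutions R V k k, (f u : LinearMap.GeneralLinearGroup R V) = f' u ∨
        (f u : LinearMap.GeneralLinearGroup R V) = -(f' u) := by
    intro f' h u
    obtain ⟨b, b', S, rfl, hb⟩ := hdiag u
    have e : f' (diagInv h2 hι b S) = diagGL b' S.1 := h b b' hb S.1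
    rw [e]
    exact (hb _ S.1 S.2 rfl).imp (fun h => Units.ext h) (fun h => Units.ext h)
  have horth : ∀ p q, Orth p q ↔ Orth (F p) (F q) := by
    have hone : ∀ {f : involutions R V k k ≃ involutions R V k k}
        {F : lineProjections R V ≃ lineProjections R V}, CommutativityPreserving f →
        (∀ b b' : Basis (Fin (2 * k)) R V, IsImage f b b' → ∀ i,
          F ⟨proj b i, proj_mem_lineProjections b i⟩ =
            ⟨proj b' i, proj_mem_lineProjections b' i⟩) →
        ∀ p q, Orth p q → Orth (F p) (F q) := by
      intro f F hf hF p q hpq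
      obtain ⟨b, i, j, hi, hj⟩ := exists_basis_proj (ι := Fin (2 * k)) h2 (hι.trans hV.symm) p.2 q.2
        (hpq.1.trans hpq.2.symm)
      obtain ⟨b', hb'⟩ := exists_isImage h2 hι hk hV hf b
      have hp : p = ⟨proj b i, proj_mem_lineProjections b i⟩ := Subtype.ext hi
      have hq : q = ⟨proj b j, proj_mem_lineProjections b j⟩ := Subtype.ext hj
      have hij : i ≠ j := by
        rintro rfl
        have h1 := hpq.1
        rw [hj, ← hi, lineProjections_mul_self p.2] at h1
        exact vec_ne_zero p (by rw [← coe_apply_vec p, h1, LinearMap.zero_apply])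
      rw [hp, hq, hF b b' hb', hF b b' hb']
      constructor
      · ext v
        simp only [Module.End.mul_apply, proj_apply b' j, map_smul,
          proj_apply_of_ne b' hij.symm, smul_zero, LinearMap.zero_apply]
      · ext v
        simp only [Module.End.mul_apply, proj_apply b' i, map_smul,
          proj_apply_of_ne b' hij, smul_zero, LinearMap.zero_apply]
    intro p q
    refine ⟨hone hf hF p q, fun h => ?_⟩
    have := hone (f := f.symm) (F := F.symm) ⟨hf.2, hf.1⟩ (fun b b' hb i => by
      rw [Equiv.symm_apply_eq, hF b' b]
      simpa using hb.symm h2 hι hk0) _ _ h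
    simpa using this
  rcases preserves_or_swaps_of_orth h2 (by omega) F horth with ⟨hr, hker⟩ | ⟨hr, hker⟩
  · obtain ⟨σ, L, hL, hLF⟩ := exists_semilinear_conj (by omega) F hr hker
    refine ⟨conjGL hL, hfinal _ fun b b' hb S => Units.ext (conjGL_eq_of_apply hL fun v => ?_)⟩
    refine apply_eq_apply_diag hL b S (fun i => ?_) v
    have h := hLF ⟨proj b i, proj_mem_lineProjections b i⟩ (b i)
    rw [hF b b' hb, proj_apply_self] at h
    rw [h]
    have h' := LinearMap.congr_fun (diag_mul_proj b' S i) (L (b i))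
    rw [Module.End.mul_apply] at h'
    refine h'.trans ?_
    split_ifs <;> rfl
  · obtain ⟨σ, L, hL, hLF⟩ := exists_semilinear_conj (by omega) (F.trans transposeProjections)
      (fun p q => by rw [hr, Equiv.trans_apply, Equiv.trans_apply, sameRange_transpose])
      (fun p q => by rw [hker, Equiv.trans_apply, Equiv.trans_apply, sameKer_transpose])
    refine ⟨contragredient hL, hfinal _ fun b b' hb S => contragredient_eq_of_transpose hL ?_⟩
    have hinv : (diagGL b S)⁻¹ = diagGL b S := rfl
    rw [← map_inv, hinv]
    refine (conjGL_eq_of_apply hL fun v => ?_).symm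
    refine apply_eq_apply_diag hL b S (fun i => ?_) v
    have h := hLF ⟨proj b i, proj_mem_lineProjections b i⟩ (b i)
    rw [Equiv.trans_apply, hF b b' hb, proj_apply_self, coe_transposeProjections] at h
    rw [h]
    have h' := LinearMap.congr_fun (congrArg transpose (proj_mul_diag b' S i)) (L (b i))
    rw [transpose_mul] at h'
    refine h'.trans ?_
    split_ifs
    · rfl
    · ext v
      simp [transpose_apply]

end Automorphism

end LinInv

theorem corollary2 {R : Type*} [DivisionRing R] {V : Type*} [AddCommGroup V] [Module R V]
    [FiniteDimensional R V] (n k : ℕ) (hV : Module.finrank R V = n)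
    (hnk : n = 2 * k) (hn : 8 ≤ n) (hR : ringChar R ≠ 2)
    (f : LinInv.involutions R V k (n - k) ≃ LinInv.involutions R V k (n - k))
    (hf : LinInv.CommutativityPreserving f) :
    ∃ f' : LinearMap.GeneralLinearGroup R V ≃* LinearMap.GeneralLinearGroup R V,
      ∀ u : LinInv.involutions R V k (n - k),
        (f u : LinearMap.GeneralLinearGroup R V) = f' u ∨
        (f u : LinearMap.GeneralLinearGroup R V) = -(f' u) := by
  have h2 : (2 : R) ≠ 0 := Ring.two_ne_zero hR
  have hm : n - k = k := by omega
  revert f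
  rw [hm]
  intro f hf
  exact LinInv.exists_mulEquiv_of_commutativityPreserving h2 (by omega) (hV.trans hnk) f hf
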